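/- A numerical semigroup is a submonoid $\Lambda=\{\lambda_0=0<\lambda_1<\lambda_2<\dots\}$ of $(\mathbb N,+)$ with finite complement; the elements of the complement are its gaps, $g$ is their number, $c$ is the largest gap plus one ($c=0$ if $\Lambda=\mathbb N$), and $k=c-g$ is the rank. Put $u_j=\lambda_{j+1}-\lambda_j$, $m=\lambda_1$, $u=u_1$, $v=u_2$. A nonzero element of $\Lambda$ is primitive if it is not the sum of two smaller elements of $\Lambda$; a right generator is a primitive element larger than every gap. In the semigroup tree (rooted at $\mathbb N$) the children of $\Lambda$ are the semigroups $\Lambda\setminus\{\mu\}$ with $\mu$ a right generator of $\Lambda$; grandchildren are children of children, and great-grandchildren are children of grandchildren. For $p<k$, an element $\lambda_s\ge c$ is an order-$p$ seed if $\lambda_s+\lambda_p\ne\lambda_i+\lambda_j$ for all $p<i\le j<s$. The seed bitstream $S=S_0\dots S_{c-1}$ has $S_i=1$ if $c+i-\lambda_j$ is an order-$j$ seed, where $j$ is the index with $\lambda_j\le i<\lambda_{j+1}$, and $S_i=0$ otherwise. Bitstreams are extended by zeros at the end; $a\ll t$ is $a_ta_{t+1}\dots$, $\land$ is the bitwise conjunction,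 and $w_i^j(a)$ is the number of nonzero bits among $a_i,\dots,a_j$. **Theorem.** Let $\Lambda$ be a numerical semigroup. It has finitely many children, grandchildren and great-grandchildren, and their numbers $n_c$, $n_{gc}$, $n_{ggc}$ are $$n_c=\begin{cases}1&k=0\\ m&k=1\\ m-1&k=2\\ w_0^{m-1}(S)&k\ge3\end{cases} \qquad n_{gc}=\begin{cases}2&k=0\\ \binom m2+3&k=1\\ \binom{n_c}2+w_0^{u-1}(S\land(S\ll m))&k>1\end{cases}$$ $$n_{ggc}=\begin{cases}4&k=0\\ \binom m3+3m+1&k=1,\ m\in\{2,3\}\\ \binom m3+3m+3&k=1,\ m\ge4\\ \binom{m-1}3+(u-\delta_a)(m-2)+\delta_b+2\delta_c+\delta_d&k=2\\ \binom{n_c}3+w_0^{u-1}(S\land(S\ll m))\,(n_c-1)+w_0^{v-1}(S\land(S\ll u)\land(S\ll(u+m)))&k\ge3\end{cases}$$ where each $\delta$ is $1$ if the following condition holds and $0$ otherwise: $\delta_a$: $m<2u$; $\delta_b$: $u=m$ or $2u\ne m$; $\delta_c$: $u<m-1$ and $2u+1\ne m$; $\delta_d$: $u=m-1$. -/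

import Mathlib

/-- A numerical semigroup: a submonoid of `(ℕ, +)` with finite complement. -/
structure NumericalSemigroup extends AddSubmonoid ℕ where
  finite_compl : (carrier)ᶜ.Finite

/-- Bitstreams `a = a₀ a₁ …`. A finite sequence of bits is identified with all its extensions by
zeros at the end, hence with the function on `ℕ` that is `false` from some index on. -/
abbrev Bitstream := ℕ → Bool

namespace Bitstream

/-- `w_i^j(a)`: the number of nonzero bits among `a_i, …, a_j`. -/
def weight (i j : ℕ) (a : Bitstream) : ℕ := ((Finset.Icc i j).filter fun l => a l = true).card

/-- `a ≪ t`: the bitstream `a_t a_{t+1} …` obtained by discarding the first `t` bits. -/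
def shift (a : Bitstream) (t : ℕ) : Bitstream := fun i => a (i + t)

/-- `a ∧ b`: the bitwise conjunction. -/
def conj (a b : Bitstream) : Bitstream := fun i => a i && b i

end Bitstream

namespace NumericalSemigroup

/-- The (finite) set of gaps. -/
noncomputable def gaps (Λ : NumericalSemigroup) : Finset ℕ := Λ.finite_compl.toFinset

/-- The genus: the number of gaps. -/
noncomputable def genus (Λ : NumericalSemigroup) : ℕ := Λ.gaps.card

/-- The conductor: the largest gap plus one, and `0` if there is no gap. -/
noncomputable def conductor (Λ : NumericalSemigroup) : ℕ := Λ.gaps.sup fun x => x + 1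

/-- The rank `c - g`. -/
noncomputable def rank (Λ : NumericalSemigroup) : ℕ := Λ.conductor - Λ.genus

/-- The increasing enumeration `0 = λ₀ < λ₁ < λ₂ < …` of the elements. -/
noncomputable def elt (Λ : NumericalSemigroup) (i : ℕ) : ℕ := Nat.nth (fun n => n ∈ Λ.carrier) i

/-- The jumps `u_j = λ_{j+1} - λ_j`. -/
noncomputable def jump (Λ : NumericalSemigroup) (j : ℕ) : ℕ := Λ.elt (j + 1) - Λ.elt j

/-- The multiplicity `λ₁`. -/
noncomputable def multiplicity (Λ : NumericalSemigroup) : ℕ := Λ.elt 1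

/-- For `p < k`, an element `x = λ_s ≥ c` is an order-`p` seed if `λ_s + λ_p ≠ λ_i + λ_j` for all
`p < i ≤ j < s`. -/
def IsSeed (Λ : NumericalSemigroup) (p x : ℕ) : Prop :=
  p < Λ.rank ∧ ∃ s, x = Λ.elt s ∧ Λ.conductor ≤ Λ.elt s ∧
    ∀ i j, p < i → i ≤ j → j < s → Λ.elt s + Λ.elt p ≠ Λ.elt i + Λ.elt j

open Classical in
/-- The seed bitstream `S = S₀ … S_{c-1}`: for `i < c`, `S_i = 1` iff `c + i - λ_j` is an order-`j`
seed, where `j` is the unique index with `λ_j ≤ i < λ_{j+1}`. -/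
noncomputable def seedBitstream (Λ : NumericalSemigroup) : Bitstream := fun i =>
  decide (i < Λ.conductor ∧
    ∃ j, Λ.elt j ≤ i ∧ i < Λ.elt (j + 1) ∧ Λ.IsSeed j (Λ.conductor + i - Λ.elt j))

theorem seedBitstream_eq_false_of_conductor_le (Λ : NumericalSemigroup) (i : ℕ)
    (h : Λ.conductor ≤ i) : Λ.seedBitstream i = false := by
  simp [seedBitstream, Nat.not_lt.mpr h]

/-- Primitive elements (minimal generators): the nonzero elements that are not a sum of two smaller
elements. -/
def IsPrimitive (Λ : NumericalSemigroup) (x : ℕ) : Prop :=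
  x ∈ Λ.carrier ∧ x ≠ 0 ∧
    ∀ a ∈ Λ.carrier, ∀ b ∈ Λ.carrier, a < x → b < x → a + b ≠ x

/-- Right generators: the primitive elements that are larger than every gap. -/
def IsRightGenerator (Λ : NumericalSemigroup) (x : ℕ) : Prop :=
  Λ.IsPrimitive x ∧ ∀ y ∈ Λ.gaps, y < x

/-- The children of `Λ` in the semigroup tree: the semigroups `Λ \ {μ}`, `μ` a right generator. -/
def children (Λ : NumericalSemigroup) : Set NumericalSemigroup :=
  {Λ' | ∃ μ, Λ.IsRightGenerator μ ∧ Λ'.carrier = Λ.carrier \ {μ}}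

/-- The grandchildren: the children of the children. -/
def grandchildren (Λ : NumericalSemigroup) : Set NumericalSemigroup :=
  {Λ'' | ∃ Λ' ∈ Λ.children, Λ'' ∈ Λ'.children}

/-- The great-grandchildren: the children of the grandchildren. -/
def greatGrandchildren (Λ : NumericalSemigroup) : Set NumericalSemigroup :=
  {Λ''' | ∃ Λ'' ∈ Λ.grandchildren, Λ''' ∈ Λ''.children}

end NumericalSemigroup

/-! Removing a right generator `μ` produces a semigroup of conductor `μ + 1`. A descendant therefore
remembers the last element removed and, by putting it back, its parent (`remove_injective`). So
descendants at depth one, two, three correspond bijectively to increasing chains `x`, `(x, y)`, `(x,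
y, z)` in which each entry is irreducible once the earlier ones are deleted, and the theorem becomes
a count of `chain₁`, `chain₂`, `chain₃`.

Ranks zero and one are explicit. For rank at least two, let `F` be the set of elements already
removed, all at least `c`. Below `c + m` a deletion changes nothing (`isIrred_diff_iff`). From `c +
m` on, the sum `m + (y - m)` must have been destroyed, so `y - m ∈ F` (`sub_mem_of_isIrred_diff`),
and what remains is an order-one seed condition (`isIrred_diff_add_iff`). A pair thus consists of
two right generators of `Λ`, or it is `(x, x + m)`.

Triples are split at `z = c + m + u`. Below it, `z` is a right generator or the `m`-translate of one
of the removed elements, the other one being arbitrary: this gives the binomial term and the product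
term. From there on, if the rank is at least three, both `z - m` and `z - (m + u)` must have been
removed, so the triple is `(x, x + u, x + m + u)` (`chain₃_high_eq`). In rank two `m + u = c` may
itself be removed, and a short list of exceptional triples produces the terms with `δ_b`, `δ_c`,
`δ_d`. Finally, the bits of the seed bitstream are exactly these irreducibility and seed conditions,
read at `c + i`. -/

/-- `x` is not a sum of two smaller elements of `M`. -/
def IsIrred (M : Set ℕ) (x : ℕ) : Prop :=
  ∀ a ∈ M, ∀ b ∈ M, a < x → b < x → a + b ≠ x

/-! ### Descendants as chains of successively removed elements. -/

namespace NumericalSemigroup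

theorem carrier_injective {Λ Λ' : NumericalSemigroup} (h : Λ.carrier = Λ'.carrier) : Λ = Λ' := by
  cases Λ with | mk A hA =>
  cases Λ' with | mk B hB =>
  have : A = B := SetLike.coe_injective h
  subst this
  rfl

theorem mem_gaps {Λ : NumericalSemigroup} {x : ℕ} : x ∈ Λ.gaps ↔ x ∉ Λ.carrier := by
  simp [gaps]

theorem conductor_le_iff {Λ : NumericalSemigroup} {x : ℕ} :
    Λ.conductor ≤ x ↔ ∀ y, y ∉ Λ.carrier → y < x := by
  simp only [conductor, Finset.sup_le_iff, mem_gaps, Nat.succ_le_iff]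

theorem mem_of_conductor_le {Λ : NumericalSemigroup} {x : ℕ} (h : Λ.conductor ≤ x) :
    x ∈ Λ.carrier := by
  by_contra hx
  exact lt_irrefl _ (conductor_le_iff.1 h x hx)

theorem zero_mem_carrier (Λ : NumericalSemigroup) : 0 ∈ Λ.carrier := Λ.zero_mem'

theorem add_mem_carrier (Λ : NumericalSemigroup) {a b : ℕ} (ha : a ∈ Λ.carrier)
    (hb : b ∈ Λ.carrier) : a + b ∈ Λ.carrier := Λ.add_mem' ha hb

theorem isRightGenerator_iff {Λ : NumericalSemigroup} {x : ℕ} :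
    Λ.IsRightGenerator x ↔ Λ.conductor ≤ x ∧ x ≠ 0 ∧ IsIrred Λ.carrier x := by
  rw [conductor_le_iff]
  constructor
  · rintro ⟨⟨h1, h2, h3⟩, h4⟩
    exact ⟨fun y hy => h4 y (mem_gaps.2 hy), h2, h3⟩
  · rintro ⟨h1, h2, h3⟩
    exact ⟨⟨mem_of_conductor_le (conductor_le_iff.2 h1), h2, h3⟩, fun y hy => h1 y (mem_gaps.1 hy)⟩

open Classical in
/-- The child of `Λ` obtained by removing the right generator `μ`. -/
noncomputable def remove (Λ : NumericalSemigroup) (μ : ℕ) : NumericalSemigroup :=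
  if h : Λ.IsRightGenerator μ then
    { carrier := Λ.carrier \ {μ}
      zero_mem' := ⟨Λ.zero_mem', fun h0 => h.1.2.1 h0.symm⟩
      add_mem' := by
        rintro a b ⟨ha, ha'⟩ ⟨hb, hb'⟩
        refine ⟨Λ.add_mem' ha hb, fun hab => ?_⟩
        simp only [Set.mem_singleton_iff] at ha' hb' hab
        exact h.1.2.2 a ha b hb (by omega) (by omega) hab
      finite_compl := by
        refine (Λ.finite_compl.union (Set.finite_singleton μ)).subset ?_
        intro x hx
        by_cases hxm : x = μ
        · exact Or.inr hxm
        · exact Or.inl fun hx' => hx ⟨hx', hxm⟩ }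
  -- Default value; `remove` is only evaluated at right generators.
  else Λ

theorem remove_carrier {Λ : NumericalSemigroup} {μ : ℕ} (h : Λ.IsRightGenerator μ) :
    (Λ.remove μ).carrier = Λ.carrier \ {μ} := by
  rw [remove, dif_pos h]

theorem remove_conductor {Λ : NumericalSemigroup} {μ : ℕ} (h : Λ.IsRightGenerator μ) :
    (Λ.remove μ).conductor = μ + 1 := by
  apply le_antisymm
  · rw [conductor_le_iff]
    intro y hy
    rw [remove_carrier h] at hy
    by_contra hlt
    exact hy ⟨mem_of_conductor_le ((isRightGenerator_iff.1 h).1.trans (by omega)),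
      fun hyμ => by simp only [Set.mem_singleton_iff] at hyμ; omega⟩
  · apply (conductor_le_iff.1 le_rfl μ)
    rw [remove_carrier h]
    exact fun hy => hy.2 rfl

/-- The conductor of the child is one more than the removed element, so the child determines that
element; putting it back recovers the parent. -/
theorem remove_injective {Λ Λ' : NumericalSemigroup} {μ μ' : ℕ} (h : Λ.IsRightGenerator μ)
    (h' : Λ'.IsRightGenerator μ') (heq : Λ.remove μ = Λ'.remove μ') : Λ = Λ' ∧ μ = μ' := by
  have hμ : μ = μ' := by
    have := congrArg conductor heq
    rw [remove_conductor h, remove_conductor h'] at this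
    omega
  subst hμ
  refine ⟨carrier_injective ?_, rfl⟩
  have hc := congrArg (fun Λ : NumericalSemigroup => Λ.carrier) heq
  simp only [remove_carrier h, remove_carrier h'] at hc
  rw [← Set.sdiff_union_of_subset (Set.singleton_subset_iff.2 h.1.1), hc,
    Set.sdiff_union_of_subset (Set.singleton_subset_iff.2 h'.1.1)]

theorem mem_children_iff {Λ Λ' : NumericalSemigroup} :
    Λ' ∈ Λ.children ↔ ∃ μ, Λ.IsRightGenerator μ ∧ Λ.remove μ = Λ' := by
  refine exists_congr fun μ => and_congr_right fun h => ?_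
  constructor
  · exact fun h' => carrier_injective (by rw [remove_carrier h, h'])
  · rintro rfl
    exact remove_carrier h

/-- The right generators. -/
def chain₁ (Λ : NumericalSemigroup) : Set ℕ :=
  {x | Λ.conductor ≤ x ∧ x ≠ 0 ∧ IsIrred Λ.carrier x}

/-- The increasing pairs of elements whose successive removal gives a grandchild. -/
def chain₂ (Λ : NumericalSemigroup) : Set (ℕ × ℕ) :=
  {p | p.1 ∈ Λ.chain₁ ∧ p.1 < p.2 ∧ IsIrred (Λ.carrier \ {p.1}) p.2}

/-- The increasing triples of elements whose successive removal gives a great-grandchild. -/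
def chain₃ (Λ : NumericalSemigroup) : Set (ℕ × ℕ × ℕ) :=
  {p | (p.1, p.2.1) ∈ Λ.chain₂ ∧ p.2.1 < p.2.2 ∧
    IsIrred (Λ.carrier \ {p.1, p.2.1}) p.2.2}

theorem mem_chain₁ {Λ : NumericalSemigroup} {x : ℕ} : x ∈ Λ.chain₁ ↔ Λ.IsRightGenerator x :=
  isRightGenerator_iff.symm

/-- The child has conductor `x + 1`, so the next element removed must be larger than `x`. This is
why chains are increasing and no descendant is reached twice. -/
theorem isRightGenerator_remove_iff {Λ : NumericalSemigroup} {x y : ℕ}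
    (hx : Λ.IsRightGenerator x) :
    (Λ.remove x).IsRightGenerator y ↔ x < y ∧ IsIrred (Λ.carrier \ {x}) y := by
  rw [isRightGenerator_iff, remove_conductor hx, remove_carrier hx]
  constructor
  · rintro ⟨h1, h2, h3⟩
    exact ⟨h1, h3⟩
  · rintro ⟨h1, h3⟩
    exact ⟨h1, by omega, h3⟩

theorem mem_chain₂ {Λ : NumericalSemigroup} {x y : ℕ} :
    (x, y) ∈ Λ.chain₂ ↔ Λ.IsRightGenerator x ∧ (Λ.remove x).IsRightGenerator y := by
  constructor
  · rintro ⟨h1, h2⟩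
    have h1 := mem_chain₁.1 h1
    exact ⟨h1, (isRightGenerator_remove_iff h1).2 h2⟩
  · rintro ⟨h1, h2⟩
    exact ⟨mem_chain₁.2 h1, (isRightGenerator_remove_iff h1).1 h2⟩

theorem mem_chain₃ {Λ : NumericalSemigroup} {x y z : ℕ} :
    (x, y, z) ∈ Λ.chain₃ ↔ Λ.IsRightGenerator x ∧ (Λ.remove x).IsRightGenerator y ∧
      ((Λ.remove x).remove y).IsRightGenerator z := by
  constructor
  · rintro ⟨h1, h2⟩
    obtain ⟨h1, h3⟩ := mem_chain₂.1 h1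
    exact ⟨h1, h3, (isRightGenerator_remove_iff h3).2 (by
      rwa [remove_carrier h1, Set.sdiff_sdiff, Set.singleton_union])⟩
  · rintro ⟨h1, h2, h3⟩
    have := (isRightGenerator_remove_iff h2).1 h3
    rw [remove_carrier h1, Set.sdiff_sdiff, Set.singleton_union] at this
    exact ⟨mem_chain₂.2 ⟨h1, h2⟩, this⟩

theorem children_eq_image (Λ : NumericalSemigroup) : Λ.children = Λ.remove '' Λ.chain₁ := by
  ext Λ'
  simp only [mem_children_iff, Set.mem_image, mem_chain₁]

theorem grandchildren_eq_image (Λ : NumericalSemigroup) :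
    Λ.grandchildren = (fun p => (Λ.remove p.1).remove p.2) '' Λ.chain₂ := by
  ext Λ'
  simp only [grandchildren, Set.mem_ofPred_eq, mem_children_iff, Set.mem_image, Prod.exists,
    mem_chain₂]
  constructor
  · rintro ⟨_, ⟨x, hx, rfl⟩, y, hy, rfl⟩
    exact ⟨x, y, ⟨hx, hy⟩, rfl⟩
  · rintro ⟨x, y, ⟨hx, hy⟩, rfl⟩
    exact ⟨_, ⟨x, hx, rfl⟩, y, hy, rfl⟩

theorem greatGrandchildren_eq_image (Λ : NumericalSemigroup) :
    Λ.greatGrandchildren =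
      (fun p => ((Λ.remove p.1).remove p.2.1).remove p.2.2) '' Λ.chain₃ := by
  ext Λ'
  simp only [greatGrandchildren, grandchildren, Set.mem_ofPred_eq, mem_children_iff, Set.mem_image,
    Prod.exists, mem_chain₃]
  constructor
  · rintro ⟨_, ⟨_, ⟨x, hx, rfl⟩, y, hy, rfl⟩, z, hz, rfl⟩
    exact ⟨x, y, z, ⟨hx, hy, hz⟩, rfl⟩
  · rintro ⟨x, y, z, ⟨hx, hy, hz⟩, rfl⟩
    exact ⟨_, ⟨_, ⟨x, hx, rfl⟩, y, hy, rfl⟩, z, hz, rfl⟩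

theorem ncard_children (Λ : NumericalSemigroup) : Λ.children.ncard = Λ.chain₁.ncard := by
  rw [children_eq_image]
  refine Set.InjOn.ncard_image fun x hx y hy h => ?_
  exact (remove_injective (mem_chain₁.1 hx) (mem_chain₁.1 hy) h).2

theorem ncard_grandchildren (Λ : NumericalSemigroup) :
    Λ.grandchildren.ncard = Λ.chain₂.ncard := by
  rw [grandchildren_eq_image]
  refine Set.InjOn.ncard_image ?_
  rintro ⟨x, y⟩ h ⟨x', y'⟩ h' heq
  obtain ⟨h1, h2⟩ := mem_chain₂.1 h
  obtain ⟨h1', h2'⟩ := mem_chain₂.1 h'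
  obtain ⟨e, rfl⟩ := remove_injective h2 h2' heq
  obtain ⟨-, rfl⟩ := remove_injective h1 h1' e
  rfl

theorem ncard_greatGrandchildren (Λ : NumericalSemigroup) :
    Λ.greatGrandchildren.ncard = Λ.chain₃.ncard := by
  rw [greatGrandchildren_eq_image]
  refine Set.InjOn.ncard_image ?_
  rintro ⟨x, y, z⟩ h ⟨x', y', z'⟩ h' heq
  obtain ⟨h1, h2, h3⟩ := mem_chain₃.1 h
  obtain ⟨h1', h2', h3'⟩ := mem_chain₃.1 h'
  obtain ⟨e₂, rfl⟩ := remove_injective h3 h3' heq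
  obtain ⟨e₁, rfl⟩ := remove_injective h2 h2' e₂
  obtain ⟨-, rfl⟩ := remove_injective h1 h1' e₁
  rfl

/-! ### Enumeration of the elements, rank and seeds. -/

theorem infinite_carrier (Λ : NumericalSemigroup) : (Set.ofPred fun n => n ∈ Λ.carrier).Infinite :=
  Set.infinite_of_finite_compl Λ.finite_compl

theorem elt_strictMono (Λ : NumericalSemigroup) : StrictMono Λ.elt :=
  Nat.nth_strictMono Λ.infinite_carrier

theorem elt_mem (Λ : NumericalSemigroup) (i : ℕ) : Λ.elt i ∈ Λ.carrier :=
  Nat.nth_mem_of_infinite Λ.infinite_carrier i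

theorem exists_elt_eq {Λ : NumericalSemigroup} {x : ℕ} (h : x ∈ Λ.carrier) :
    ∃ i, Λ.elt i = x := by
  classical
  exact ⟨_, Nat.nth_count h⟩

theorem elt_zero (Λ : NumericalSemigroup) : Λ.elt 0 = 0 := by
  obtain ⟨i, hi⟩ := exists_elt_eq Λ.zero_mem_carrier
  have := Λ.elt_strictMono.monotone (Nat.zero_le i)
  omega

/-- All gaps lie below `c`, so `c - g` counts the elements there; this places the conductor at index
`k` of the enumeration. -/
theorem rank_eq_count (Λ : NumericalSemigroup) [DecidablePred fun n => n ∈ Λ.carrier] :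
    Λ.rank = Nat.count (fun n => n ∈ Λ.carrier) Λ.conductor := by
  have h1 : Λ.gaps = (Finset.range Λ.conductor).filter fun n => n ∉ Λ.carrier := by
    ext x
    simp only [mem_gaps, Finset.mem_filter, Finset.mem_range]
    exact ⟨fun h => ⟨conductor_le_iff.1 le_rfl x h, h⟩, fun h => h.2⟩
  have h2 := Finset.card_filter_add_card_filter_not (s := Finset.range Λ.conductor)
    (fun n => n ∈ Λ.carrier)
  rw [Finset.card_range] at h2
  rw [Nat.count_eq_card_filter_range, rank, genus, h1]
  omega

theorem elt_rank (Λ : NumericalSemigroup) : Λ.elt Λ.rank = Λ.conductor := by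
  classical
  rw [rank_eq_count]
  exact Nat.nth_count (p := fun n => n ∈ Λ.carrier) (mem_of_conductor_le le_rfl)

/-- Indices disappear: if two elements exceed `λ_p` and sum to `λ_s + λ_p`, both are automatically
below `λ_s`, so the bound `j < s` costs nothing. -/
theorem isSeed_iff {Λ : NumericalSemigroup} {p x : ℕ} :
    Λ.IsSeed p x ↔ p < Λ.rank ∧ Λ.conductor ≤ x ∧ ∀ a ∈ Λ.carrier, ∀ b ∈ Λ.carrier,
      Λ.elt p < a → Λ.elt p < b → a + b ≠ x + Λ.elt p := by
  have hs := Λ.elt_strictMono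
  refine and_congr_right fun _ => ?_
  constructor
  · rintro ⟨s, rfl, h1, h2⟩
    refine ⟨h1, fun a ha b hb hpa hpb heq => ?_⟩
    obtain ⟨i, rfl⟩ := exists_elt_eq ha
    obtain ⟨j, rfl⟩ := exists_elt_eq hb
    have hi : i < s := hs.lt_iff_lt.1 (by omega)
    have hj : j < s := hs.lt_iff_lt.1 (by omega)
    rcases le_total i j with hij | hij
    · exact h2 i j (hs.lt_iff_lt.1 hpa) hij hj heq.symm
    · exact h2 j i (hs.lt_iff_lt.1 hpb) hij hi (by omega)
  · rintro ⟨h1, h2⟩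
    obtain ⟨s, rfl⟩ := exists_elt_eq (mem_of_conductor_le h1)
    refine ⟨s, rfl, h1, fun i j hpi hij hjs heq => ?_⟩
    exact h2 _ (Λ.elt_mem i) _ (Λ.elt_mem j) (hs hpi) (hs (hpi.trans_le hij)) heq.symm

theorem seedBitstream_elt_add {Λ : NumericalSemigroup} {j i : ℕ} (hj : j < Λ.rank)
    (hi : i < Λ.jump j) : Λ.seedBitstream (Λ.elt j + i) = true ↔
      ∀ a ∈ Λ.carrier, ∀ b ∈ Λ.carrier, Λ.elt j < a → Λ.elt j < b →
        a + b ≠ Λ.conductor + i + Λ.elt j := by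
  have hs := Λ.elt_strictMono
  have hlt : Λ.elt j + i < Λ.elt (j + 1) := by unfold jump at hi; omega
  have hle : Λ.elt (j + 1) ≤ Λ.conductor := Λ.elt_rank ▸ hs.monotone hj
  have hsub : Λ.conductor + (Λ.elt j + i) - Λ.elt j = Λ.conductor + i := by omega
  simp only [seedBitstream, decide_eq_true_eq]
  constructor
  · rintro ⟨-, j', h1, h2, h3⟩
    have e1 : j' < j + 1 := hs.lt_iff_lt.1 (h1.trans_lt hlt)
    have e2 : j < j' + 1 := hs.lt_iff_lt.1 (by omega)
    obtain rfl : j' = j := by omega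
    rw [hsub] at h3
    exact (isSeed_iff.1 h3).2.2
  · intro h
    refine ⟨by omega, j, by omega, hlt, ?_⟩
    rw [hsub]
    exact isSeed_iff.2 ⟨hj, by omega, h⟩

theorem eq_elt_of_lt {Λ : NumericalSemigroup} {x j : ℕ} (hx : x ∈ Λ.carrier)
    (h : x < Λ.elt j) : ∃ i < j, x = Λ.elt i := by
  obtain ⟨i, rfl⟩ := exists_elt_eq hx
  exact ⟨i, Λ.elt_strictMono.lt_iff_lt.1 h, rfl⟩

end NumericalSemigroup

/-! ### Counting increasing pairs and triples; weights as cardinalities. -/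

/-- The increasing pairs of elements of `s`. -/
def incPairs (s : Finset ℕ) : Finset (ℕ × ℕ) := (s ×ˢ s).filter fun p => p.1 < p.2

/-- The increasing triples of elements of `s`. -/
def incTriples (s : Finset ℕ) : Finset (ℕ × ℕ × ℕ) :=
  (s ×ˢ s ×ˢ s).filter fun p => p.1 < p.2.1 ∧ p.2.1 < p.2.2

theorem mem_incPairs {s : Finset ℕ} {x y : ℕ} : (x, y) ∈ incPairs s ↔ x ∈ s ∧ y ∈ s ∧ x < y := by
  simp [incPairs, and_assoc]

theorem mem_incTriples {s : Finset ℕ} {x y z : ℕ} :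
    (x, y, z) ∈ incTriples s ↔ x ∈ s ∧ y ∈ s ∧ z ∈ s ∧ x < y ∧ y < z := by
  simp [incTriples, and_assoc]

theorem card_incPairs (s : Finset ℕ) : (incPairs s).card = s.card.choose 2 := by
  induction s using Finset.induction_on_max with
  | empty => rfl
  | insert a s ha ih =>
    have has : a ∉ s := fun h => lt_irrefl _ (ha a h)
    -- As `a` is the maximum, it can only be the last entry; the count is then Pascal's rule.
    have h : incPairs (insert a s) = incPairs s ∪ s.image fun x => (x, a) := by
      ext ⟨x, y⟩
      simp only [mem_incPairs, Finset.mem_union, Finset.mem_image, Finset.mem_insert,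
        Prod.mk.injEq]
      constructor
      · rintro ⟨rfl | hx, rfl | hy, hxy⟩
        · exact absurd hxy (lt_irrefl _)
        · exact absurd (ha y hy) (by omega)
        · exact Or.inr ⟨x, hx, rfl, rfl⟩
        · exact Or.inl ⟨hx, hy, hxy⟩
      · rintro (⟨hx, hy, hxy⟩ | ⟨x, hx, rfl, rfl⟩)
        · exact ⟨Or.inr hx, Or.inr hy, hxy⟩
        · exact ⟨Or.inr hx, Or.inl rfl, ha x hx⟩
    rw [h, Finset.card_union_of_disjoint, ih, Finset.card_image_of_injective,
      Finset.card_insert_of_notMem has, Nat.choose_succ_succ' _ 1, Nat.choose_one_right, add_comm]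
    · exact fun x y hxy => (Prod.mk.inj hxy).1
    · rw [Finset.disjoint_left]
      rintro ⟨x, y⟩ h1 h2
      obtain ⟨_, _, h2⟩ := Finset.mem_image.1 h2
      obtain ⟨_, rfl⟩ := Prod.mk.inj h2
      exact has (mem_incPairs.1 h1).2.1

theorem card_incTriples (s : Finset ℕ) : (incTriples s).card = s.card.choose 3 := by
  induction s using Finset.induction_on_max with
  | empty => rfl
  | insert a s ha ih =>
    have has : a ∉ s := fun h => lt_irrefl _ (ha a h)
    have h : incTriples (insert a s) =
        incTriples s ∪ (incPairs s).image fun p => (p.1, p.2, a) := by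
      ext ⟨x, y, z⟩
      simp only [mem_incTriples, Finset.mem_union, Finset.mem_image, Finset.mem_insert,
        Prod.mk.injEq, Prod.exists, mem_incPairs]
      constructor
      · rintro ⟨hx, hy, hz, hxy, hyz⟩
        have hle : ∀ w, w = a ∨ w ∈ s → w ≤ a := by
          rintro w (rfl | hw)
          · exact le_rfl
          · exact (ha w hw).le
        have hza := hle z hz
        have hx' := hx.resolve_left (by omega)
        have hy' := hy.resolve_left (by omega)
        rcases hz with rfl | hz
        · exact Or.inr ⟨x, y, ⟨hx', hy', hxy⟩, rfl, rfl, rfl⟩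
        · exact Or.inl ⟨hx', hy', hz, hxy, hyz⟩
      · rintro (⟨hx, hy, hz, hxy, hyz⟩ | ⟨x, y, ⟨hx, hy, hxy⟩, rfl, rfl, rfl⟩)
        · exact ⟨Or.inr hx, Or.inr hy, Or.inr hz, hxy, hyz⟩
        · exact ⟨Or.inr hx, Or.inr hy, Or.inl rfl, hxy, ha y hy⟩
    rw [h, Finset.card_union_of_disjoint, ih, Finset.card_image_of_injective, card_incPairs,
      Finset.card_insert_of_notMem has, Nat.choose_succ_succ' _ 2, add_comm]
    · rintro ⟨x, y⟩ ⟨x', y'⟩ hxy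
      simp only [Prod.mk.injEq] at hxy ⊢
      exact ⟨hxy.1, hxy.2.1⟩
    · rw [Finset.disjoint_left]
      rintro ⟨x, y, z⟩ h1 h2
      obtain ⟨_, _, h2⟩ := Finset.mem_image.1 h2
      simp only [Prod.mk.injEq] at h2
      obtain ⟨_, _, rfl⟩ := h2
      exact has (mem_incTriples.1 h1).2.2.1

/-- Positivity of `n` matters: with truncated subtraction the window `0, …, n - 1` would still
contain the bit `0` for `n = 0`. -/
theorem Bitstream.weight_eq_card_filter_Ico {a : Bitstream} {n c : ℕ} (hn : 0 < n)
    (p : ℕ → Prop) [DecidablePred p] (h : ∀ i < n, a i = true ↔ p (c + i)) :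
    a.weight 0 (n - 1) = ((Finset.Ico c (c + n)).filter p).card := by
  refine Finset.card_bij (fun i _ => c + i) ?_ ?_ ?_
  · intro i hi
    simp only [Finset.mem_filter, Finset.mem_Icc, Finset.mem_Ico] at hi ⊢
    exact ⟨by omega, (h i (by omega)).1 hi.2⟩
  · intro i _ j _ hij
    omega
  · intro x hx
    simp only [Finset.mem_filter, Finset.mem_Ico] at hx
    refine ⟨x - c, ?_, by omega⟩
    simp only [Finset.mem_filter, Finset.mem_Icc]
    refine ⟨by omega, (h _ (by omega)).2 ?_⟩
    rw [show c + (x - c) = x by omega]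
    exact hx.2

/-! ### Ranks zero and one: explicit enumeration. -/

namespace NumericalSemigroup

section RankZero

variable {Λ : NumericalSemigroup}

theorem chain₁_of_conductor_eq_zero (hM : ∀ x, x ∈ Λ.carrier) (hc : Λ.conductor = 0) :
    Λ.chain₁ = {1} := by
  ext x
  simp only [chain₁, Set.mem_ofPred_eq, hc, IsIrred, hM, Set.mem_singleton_iff, forall_const]
  constructor
  · rintro ⟨-, h1, h2⟩
    by_contra hx
    exact h2 1 (x - 1) (by omega) (by omega) (by omega)
  · rintro rfl
    exact ⟨by omega, by omega, fun a b ha hb => by omega⟩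

theorem chain₂_of_conductor_eq_zero (hM : ∀ x, x ∈ Λ.carrier) (hc : Λ.conductor = 0) :
    Λ.chain₂ = {(1, 2), (1, 3)} := by
  ext ⟨x, y⟩
  simp only [chain₂, Set.mem_ofPred_eq, chain₁_of_conductor_eq_zero hM hc, IsIrred, Set.mem_sdiff,
    hM, Set.mem_singleton_iff, true_and, Set.mem_insert_iff, Prod.mk.injEq]
  constructor
  · rintro ⟨rfl, h1, h2⟩
    have := h2 2 (by omega) (y - 2)
    omega
  · rintro (⟨rfl, rfl⟩ | ⟨rfl, rfl⟩) <;>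
    exact ⟨rfl, by omega, fun a ha b hb _ _ => by omega⟩

theorem chain₃_of_conductor_eq_zero (hM : ∀ x, x ∈ Λ.carrier) (hc : Λ.conductor = 0) :
    Λ.chain₃ = {(1, 2, 3), (1, 2, 4), (1, 2, 5), (1, 3, 5)} := by
  ext ⟨x, y, z⟩
  simp only [chain₃, Set.mem_ofPred_eq, chain₂_of_conductor_eq_zero hM hc, IsIrred, Set.mem_sdiff,
    hM, Set.mem_singleton_iff, true_and, Set.mem_insert_iff, Prod.mk.injEq]
  constructor
  · rintro ⟨⟨rfl, rfl⟩ | ⟨rfl, rfl⟩, h1, h2⟩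
    · have := h2 3 (by omega) (z - 3)
      omega
    · have := h2 2 (by omega) (z - 2)
      omega
  · rintro (⟨rfl, rfl, rfl⟩ | ⟨rfl, rfl, rfl⟩ | ⟨rfl, rfl, rfl⟩ | ⟨rfl, rfl, rfl⟩) <;>
    exact ⟨by omega, by omega, fun a ha b hb _ _ => by omega⟩

end RankZero

section RankOne

variable {Λ : NumericalSemigroup} {m : ℕ}

theorem chain₁_of_ordinary (hm : 2 ≤ m) (hM : ∀ x, x ∈ Λ.carrier ↔ x = 0 ∨ m ≤ x)
    (hc : Λ.conductor = m) : Λ.chain₁ = Finset.Ico m (2 * m) := by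
  ext x
  simp only [chain₁, Set.mem_ofPred_eq, hc, IsIrred, hM, Finset.coe_Ico, Set.mem_Ico]
  constructor
  · rintro ⟨h1, h2, h3⟩
    have := h3 m (by omega) (x - m)
    omega
  · intro h
    exact ⟨by omega, by omega, fun a _ b _ _ _ => by omega⟩

theorem mem_chain₂_of_ordinary (hm : 2 ≤ m) (hM : ∀ x, x ∈ Λ.carrier ↔ x = 0 ∨ m ≤ x)
    (hc : Λ.conductor = m) {x y : ℕ} : (x, y) ∈ Λ.chain₂ ↔ m ≤ x ∧ x < y ∧
      (y < 2 * m ∨ x = m ∧ y = 2 * m ∨ x = m ∧ y = 2 * m + 1 ∨ x = m + 1 ∧ y = 2 * m + 1) := by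
  simp only [chain₂, Set.mem_ofPred_eq, chain₁_of_ordinary hm hM hc, IsIrred, Set.mem_sdiff,
    hM, Set.mem_singleton_iff, Finset.coe_Ico, Set.mem_Ico]
  constructor
  · rintro ⟨h1, h2, h3⟩
    -- For `y ≥ 2m + 2` the sums `m + (y - m)` and `(m + 1) + (y - m - 1)` share no summand, so
    -- deleting `x` alone cannot spoil both.
    have e0 := h3 m
    have e1 := h3 (m + 1)
    have e0 := fun h => e0 h (y - m)
    have e1 := fun h => e1 h (y - (m + 1))
    omega
  · intro h
    exact ⟨by omega, by omega, fun a _ b _ _ _ => by omega⟩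

theorem mem_chain₃_of_ordinary (hm : 2 ≤ m) (hM : ∀ x, x ∈ Λ.carrier ↔ x = 0 ∨ m ≤ x)
    (hc : Λ.conductor = m) {x y z : ℕ} : (x, y, z) ∈ Λ.chain₃ ↔ m ≤ x ∧ x < y ∧ y < z ∧
      (y < 2 * m ∨ x = m ∧ y = 2 * m ∨ x = m ∧ y = 2 * m + 1 ∨ x = m + 1 ∧ y = 2 * m + 1) ∧
      (z < 2 * m ∨ z = 2 * m ∧ x = m ∨ z = 2 * m + 1 ∧ (x = m ∨ x = m + 1) ∨
        z = 2 * m + 2 ∧ (x = m ∧ y = m + 1 ∨ x = m + 1 ∧ y = m + 2) ∨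
        z = 2 * m + 3 ∧ (x = m ∧ y = m + 1 ∨ x = m ∧ y = m + 2 ∨ x = m + 1 ∧ y = m + 3 ∨
          x = m + 2 ∧ y = m + 3)) := by
  simp only [chain₃, Set.mem_ofPred_eq, mem_chain₂_of_ordinary hm hM hc, IsIrred, Set.mem_sdiff,
    hM, Set.mem_singleton_iff, Set.mem_insert_iff, not_or]
  constructor
  · rintro ⟨⟨h1, h2, h4⟩, h5, h3⟩
    -- Each sum `(m + i) + (z - m - i)` has to lose a summand. For `z ≥ 2m + 4` the cases `i = 0, 1,
    -- 2` have pairwise disjoint summands, too many for two deletions; hence `z ≤ 2m + 3`.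
    have e : ∀ i, 2 * m + 2 * i ≤ z → m + i = x ∨ m + i = y ∨ z - (m + i) = x ∨
        z - (m + i) = y := by
      intro i hi
      by_contra hne
      simp only [not_or] at hne
      exact h3 (m + i) ⟨by omega, hne.1, hne.2.1⟩ (z - (m + i)) ⟨by omega, hne.2.2⟩ (by omega)
        (by omega) (by omega)
    have e0 := e 0
    have e1 := e 1
    have e2 := e 2
    clear h3 e
    refine ⟨h1, h2, h5, h4, ?_⟩
    rcases Nat.lt_or_ge z (2 * m) with h | h
    · exact Or.inl h
    have hz : z ≤ 2 * m + 3 := by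
      by_contra hz
      have e0 := e0 (by omega)
      have e1 := e1 (by omega)
      have e2 := e2 (by omega)
      clear h4
      omega
    clear h4
    obtain rfl | rfl | rfl | rfl : z = 2 * m ∨ z = 2 * m + 1 ∨ z = 2 * m + 2 ∨ z = 2 * m + 3 := by
      omega
    · have e0 := e0 (by omega)
      exact Or.inr (Or.inl ⟨rfl, by omega⟩)
    · have e0 := e0 (by omega)
      exact Or.inr (Or.inr (Or.inl ⟨rfl, by omega⟩))
    · have e0 := e0 (by omega)
      have e1 := e1 (by omega)
      refine Or.inr (Or.inr (Or.inr (Or.inl ⟨rfl, ?_⟩)))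
      clear e2 hz h h5
      omega
    · have e0 := e0 (by omega)
      have e1 := e1 (by omega)
      refine Or.inr (Or.inr (Or.inr (Or.inr ⟨rfl, ?_⟩)))
      clear e2 hz h h5
      omega
  · rintro ⟨h1, h2, h5, h4, h6⟩
    refine ⟨⟨h1, h2, h4⟩, h5, ?_⟩
    clear h4
    rintro a ⟨ha, hax, hay⟩ b ⟨hb, hbx, hby⟩ haz hbz hab
    obtain h6 | ⟨rfl, rfl⟩ | ⟨rfl, rfl | rfl⟩ | ⟨rfl, ⟨rfl, rfl⟩ | ⟨rfl, rfl⟩⟩ |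
      ⟨rfl, ⟨rfl, rfl⟩ | ⟨rfl, rfl⟩ | ⟨rfl, rfl⟩ | ⟨rfl, rfl⟩⟩ := h6 <;> omega

theorem chain₂_of_ordinary (hm : 2 ≤ m) (hM : ∀ x, x ∈ Λ.carrier ↔ x = 0 ∨ m ≤ x)
    (hc : Λ.conductor = m) : Λ.chain₂ =
      (incPairs (Finset.Ico m (2 * m)) ∪ {(m, 2 * m), (m, 2 * m + 1), (m + 1, 2 * m + 1)} :
        Finset (ℕ × ℕ)) := by
  ext ⟨x, y⟩
  simp only [mem_chain₂_of_ordinary hm hM hc, Finset.mem_coe, Finset.mem_union, mem_incPairs,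
    Finset.mem_insert, Finset.mem_singleton, Prod.mk.injEq, Finset.mem_Ico]
  omega

theorem ncard_chain₂_of_ordinary (hm : 2 ≤ m) (hM : ∀ x, x ∈ Λ.carrier ↔ x = 0 ∨ m ≤ x)
    (hc : Λ.conductor = m) : Λ.chain₂.ncard = m.choose 2 + 3 := by
  rw [chain₂_of_ordinary hm hM hc, Set.ncard_coe_finset, Finset.card_union_of_disjoint,
    card_incPairs, Nat.card_Ico, show 2 * m - m = m by omega]
  · rw [Finset.card_eq_three.2 ⟨_, _, _, _, _, _, rfl⟩] <;> simp
  · rw [Finset.disjoint_left]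
    rintro ⟨x, y⟩
    simp only [mem_incPairs, Finset.mem_insert, Finset.mem_singleton, Prod.mk.injEq,
      Finset.mem_Ico]
    omega

end RankOne

end NumericalSemigroup

namespace NumericalSemigroup
variable {Λ : NumericalSemigroup} {m : ℕ}

theorem ncard_chain₃_of_ordinary_two (hM : ∀ x, x ∈ Λ.carrier ↔ x = 0 ∨ 2 ≤ x)
    (hc : Λ.conductor = 2) : Λ.chain₃.ncard = 7 := by
  have h : Λ.chain₃ = (({(2, 3, 4), (2, 3, 5), (2, 3, 6), (2, 3, 7), (2, 4, 5), (2, 4, 7),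
      (3, 5, 7)} : Finset (ℕ × ℕ × ℕ)) : Set (ℕ × ℕ × ℕ)) := by
    ext ⟨x, y, z⟩
    rw [mem_chain₃_of_ordinary le_rfl hM hc]
    simp only [Finset.mem_coe, Finset.mem_insert, Finset.mem_singleton, Prod.mk.injEq]
    constructor
    · rintro ⟨h1, h2, h3, h4, h5⟩
      have hz : z ≤ 7 := by
        clear h4
        omega
      interval_cases z <;> interval_cases y <;> interval_cases x <;> simp_all
    · rintro h
      obtain ⟨rfl, rfl, rfl⟩ | ⟨rfl, rfl, rfl⟩ | ⟨rfl, rfl, rfl⟩ | ⟨rfl, rfl, rfl⟩ |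
        ⟨rfl, rfl, rfl⟩ | ⟨rfl, rfl, rfl⟩ | ⟨rfl, rfl, rfl⟩ := h <;> decide
  rw [h, Set.ncard_coe_finset]
  rfl

theorem ncard_chain₃_of_ordinary_three (hM : ∀ x, x ∈ Λ.carrier ↔ x = 0 ∨ 3 ≤ x)
    (hc : Λ.conductor = 3) : Λ.chain₃.ncard = 11 := by
  have h : Λ.chain₃ = (({(3, 4, 5), (3, 4, 6), (3, 5, 6), (3, 4, 7), (3, 5, 7), (4, 5, 7),
      (3, 4, 8), (4, 5, 8), (3, 4, 9), (3, 5, 9), (3, 6, 7)} : Finset (ℕ × ℕ × ℕ)) :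
        Set (ℕ × ℕ × ℕ)) := by
    ext ⟨x, y, z⟩
    rw [mem_chain₃_of_ordinary (by omega) hM hc]
    simp only [Finset.mem_coe, Finset.mem_insert, Finset.mem_singleton, Prod.mk.injEq]
    constructor
    · rintro ⟨h1, h2, h3, h4, h5⟩
      have hz : z ≤ 9 := by
        clear h4
        omega
      interval_cases z <;> interval_cases y <;> interval_cases x <;> simp_all
    · rintro h
      obtain ⟨rfl, rfl, rfl⟩ | ⟨rfl, rfl, rfl⟩ | ⟨rfl, rfl, rfl⟩ | ⟨rfl, rfl, rfl⟩ |
        ⟨rfl, rfl, rfl⟩ | ⟨rfl, rfl, rfl⟩ | ⟨rfl, rfl, rfl⟩ | ⟨rfl, rfl, rfl⟩ |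
        ⟨rfl, rfl, rfl⟩ | ⟨rfl, rfl, rfl⟩ | ⟨rfl, rfl, rfl⟩ := h <;> decide
  rw [h, Set.ncard_coe_finset]
  rfl

/-- The bound `4 ≤ m` puts `m + 1`, `m + 2`, `m + 3` below `2 * m`, so all the exceptional triples
start with an admissible pair. For `m = 3` the pairs `(4, 6)`, `(5, 6)` and for `m = 2` the pairs
`(3, 4)`, `(4, 5)` are inadmissible, which lowers the constant from `3` to `1`. -/
theorem chain₃_of_ordinary (hm : 4 ≤ m) (hM : ∀ x, x ∈ Λ.carrier ↔ x = 0 ∨ m ≤ x)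
    (hc : Λ.conductor = m) : Λ.chain₃ =
      (incTriples (Finset.Ico m (2 * m)) ∪
        ((Finset.Ioo m (2 * m)).image (fun y => (m, y, 2 * m)) ∪
        ((Finset.Ioo m (2 * m)).image (fun y => (m, y, 2 * m + 1)) ∪
        ((Finset.Ioo (m + 1) (2 * m)).image (fun y => (m + 1, y, 2 * m + 1)) ∪
        {(m, 2 * m, 2 * m + 1), (m, m + 1, 2 * m + 2), (m + 1, m + 2, 2 * m + 2),
          (m, m + 1, 2 * m + 3), (m, m + 2, 2 * m + 3), (m + 1, m + 3, 2 * m + 3),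
          (m + 2, m + 3, 2 * m + 3)}))) : Finset (ℕ × ℕ × ℕ)) := by
  ext ⟨x, y, z⟩
  simp only [mem_chain₃_of_ordinary (by omega : 2 ≤ m) hM hc, Finset.mem_coe, Finset.mem_union,
    mem_incTriples, Finset.mem_insert, Finset.mem_singleton, Finset.mem_image, Prod.mk.injEq,
    Finset.mem_Ico, Finset.mem_Ioo]
  constructor
  · rintro ⟨h1, h2, h3, h4, h5⟩
    by_cases hy : y < 2 * m
    · clear h4
      rcases h5 with h5 | ⟨rfl, rfl⟩ | ⟨rfl, rfl | rfl⟩ | h5 | h5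
      · exact Or.inl (by omega)
      · exact Or.inr (Or.inl ⟨y, by omega, rfl, rfl, rfl⟩)
      · exact Or.inr (Or.inr (Or.inl ⟨y, by omega, rfl, rfl, rfl⟩))
      · exact Or.inr (Or.inr (Or.inr (Or.inl ⟨y, by omega, rfl, rfl, rfl⟩)))
      · exact Or.inr (Or.inr (Or.inr (Or.inr (by omega))))
      · exact Or.inr (Or.inr (Or.inr (Or.inr (by omega))))
    · refine Or.inr (Or.inr (Or.inr (Or.inr (Or.inl ?_))))
      rcases h4 with h4 | ⟨rfl, rfl⟩ | ⟨rfl, rfl⟩ | ⟨rfl, rfl⟩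
      · exact absurd h4 hy
      all_goals omega
  · rintro (h | ⟨y, h, rfl, rfl, rfl⟩ | ⟨y, h, rfl, rfl, rfl⟩ | ⟨y, h, rfl, rfl, rfl⟩ | h)
    · exact ⟨by omega, by omega, by omega, by omega, by omega⟩
    · exact ⟨by omega, by omega, by omega, Or.inl (by omega), Or.inr (Or.inl (by omega))⟩
    · exact ⟨by omega, by omega, by omega, Or.inl (by omega), Or.inr (Or.inr (Or.inl (by omega)))⟩
    · exact ⟨by omega, by omega, by omega, Or.inl (by omega), Or.inr (Or.inr (Or.inl (by omega)))⟩
    · obtain ⟨rfl, rfl, rfl⟩ | ⟨rfl, rfl, rfl⟩ | ⟨rfl, rfl, rfl⟩ | ⟨rfl, rfl, rfl⟩ |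
        ⟨rfl, rfl, rfl⟩ | ⟨rfl, rfl, rfl⟩ | ⟨rfl, rfl, rfl⟩ := h
      · exact ⟨by omega, by omega, by omega, by omega, by omega⟩
      · exact ⟨by omega, by omega, by omega, Or.inl (by omega),
          Or.inr (Or.inr (Or.inr (Or.inl (by simp))))⟩
      · exact ⟨by omega, by omega, by omega, Or.inl (by omega),
          Or.inr (Or.inr (Or.inr (Or.inl (by simp))))⟩
      all_goals exact ⟨by omega, by omega, by omega, Or.inl (by omega),
        Or.inr (Or.inr (Or.inr (Or.inr (by simp))))⟩

theorem ncard_chain₃_of_ordinary (hm : 4 ≤ m) (hM : ∀ x, x ∈ Λ.carrier ↔ x = 0 ∨ m ≤ x)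
    (hc : Λ.conductor = m) : Λ.chain₃.ncard = m.choose 3 + 3 * m + 3 := by
  have hinj : ∀ a b : ℕ, Function.Injective fun y : ℕ => (a, y, b) := by
    intro a b y y' h
    simpa using h
  rw [chain₃_of_ordinary hm hM hc, Set.ncard_coe_finset, Finset.card_union_of_disjoint,
    Finset.card_union_of_disjoint, Finset.card_union_of_disjoint, Finset.card_union_of_disjoint,
    card_incTriples, Finset.card_image_of_injective _ (hinj _ _),
    Finset.card_image_of_injective _ (hinj _ _), Finset.card_image_of_injective _ (hinj _ _),
    Nat.card_Ico, Nat.card_Ioo, Nat.card_Ioo, show 2 * m - m = m by omega]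
  · rw [Finset.card_insert_of_notMem, Finset.card_insert_of_notMem, Finset.card_insert_of_notMem,
      Finset.card_insert_of_notMem, Finset.card_insert_of_notMem, Finset.card_insert_of_notMem,
      Finset.card_singleton]
    · omega
    all_goals
      simp only [Finset.mem_insert, Finset.mem_singleton, Prod.mk.injEq]
      omega
  all_goals
    rw [Finset.disjoint_left]
    rintro ⟨x, y, z⟩
    simp only [Finset.mem_union, mem_incTriples, Finset.mem_insert, Finset.mem_singleton,
      Finset.mem_image, Prod.mk.injEq, Finset.mem_Ico, Finset.mem_Ioo, not_or]
  · rintro ⟨y', h1, rfl, rfl, rfl⟩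
    omega
  · rintro ⟨y', h1, rfl, rfl, rfl⟩
    refine ⟨?_, by omega⟩
    rintro ⟨y', h1, h2⟩
    omega
  · rintro ⟨y', h1, rfl, rfl, rfl⟩
    refine ⟨?_, ?_, by omega⟩
    · rintro ⟨y', h1, h2⟩
      omega
    · rintro ⟨y', h1, h2⟩
      omega
  · intro h
    refine ⟨?_, ?_, ?_, by omega⟩
    · rintro ⟨y', h1, h2⟩
      omega
    · rintro ⟨y', h1, h2⟩
      omega
    · rintro ⟨y', h1, h2⟩
      omega

end NumericalSemigroup

/-! ### Rank at least two: pairs, and triples with small last entry. -/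

/-- `x + e` is not a sum of two elements of `M` larger than `e`. -/
def NoLargeSum (M : Set ℕ) (e x : ℕ) : Prop :=
  ∀ a ∈ M, ∀ b ∈ M, e < a → e < b → a + b ≠ x + e

namespace NumericalSemigroup

/-- The first elements of a numerical semigroup of rank at least two: `m` and `m + u` are the two
smallest nonzero elements, and `c` is the conductor. -/
structure IsInitial (Λ : NumericalSemigroup) (c m u : ℕ) : Prop where
  conductor_eq : Λ.conductor = c
  lt_conductor : m < c
  add_le_conductor : m + u ≤ c
  pos : 0 < u
  le : u ≤ m
  mem_of_le : ∀ x, c ≤ x → x ∈ Λ.carrier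
  mem_left : m ∈ Λ.carrier
  mem_add : m + u ∈ Λ.carrier
  eq_of_lt : ∀ x ∈ Λ.carrier, x < m + u → x = 0 ∨ x = m

open Classical in
/-- The right generators of a semigroup of rank at least two. -/
noncomputable def rightGens (Λ : NumericalSemigroup) (c m : ℕ) :
    Finset ℕ := (Finset.Ico c (c + m)).filter fun x => IsIrred Λ.carrier x

open Classical in
/-- The right generators `x` such that `x + m` is a right generator of `Λ \ {x}`. -/
noncomputable def newGens (Λ : NumericalSemigroup) (c m u : ℕ) :
    Finset ℕ := (Finset.Ico c (c + u)).filter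
      fun x => IsIrred Λ.carrier x ∧ NoLargeSum Λ.carrier m x

theorem mem_chain₃_iff {Λ : NumericalSemigroup} {x y z : ℕ} : (x, y, z) ∈ Λ.chain₃ ↔
    (x, y) ∈ Λ.chain₂ ∧ y < z ∧ IsIrred (Λ.carrier \ {x, y}) z := Iff.rfl

variable {Λ : NumericalSemigroup} {c m u : ℕ}

namespace IsInitial

/-- A summand in `F` is at least `c`, which leaves less than `m` for the other; that one is then
`0`, and the first summand is not smaller than `y`. -/
theorem isIrred_diff_iff (h : Λ.IsInitial c m u) {F : Set ℕ} (hF : ∀ f ∈ F, c ≤ f) {y : ℕ}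
    (hy : y < c + m) : IsIrred (Λ.carrier \ F) y ↔ IsIrred Λ.carrier y := by
  have hm := h.eq_of_lt
  have hu := h.pos
  constructor
  · intro H a ha b hb hay hby hab
    have key : ∀ a b, b ∈ Λ.carrier → a < y → a + b = y → a ∉ F := by
      intro a b hb hay hab haF
      have := hF a haF
      have := hm b hb (by omega)
      omega
    exact H a ⟨ha, key a b hb hay hab⟩ b ⟨hb, key b a ha hby (by omega)⟩ hay hby hab
  · exact fun H a ha b hb => H a ha.1 b hb.1

/-- Since `m < c` is never removed and `y - m ≥ c` belongs to `Λ`, the sum `m + (y - m)` can only be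
destroyed by removing `y - m`. -/
theorem sub_mem_of_isIrred_diff (h : Λ.IsInitial c m u) {F : Set ℕ} (hF : ∀ f ∈ F, c ≤ f) {y : ℕ}
    (hy : c + m ≤ y) (H : IsIrred (Λ.carrier \ F) y) : y - m ∈ F := by
  have h1 := h.lt_conductor
  have h2 := h.pos
  have h3 := h.le
  by_contra hn
  refine H m ⟨h.mem_left, fun hmF => ?_⟩ (y - m) ⟨h.mem_of_le _ (by omega), hn⟩ (by omega)
    (by omega) (by omega)
  have := hF m hmF
  omega

/-- Sums involving `0` or `m` are harmless because `x ∈ F`. In any other sum both summands are at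
least `m + u`, hence at most `x - u < c`, so `F` does not meet them. -/
theorem isIrred_diff_add_iff (h : Λ.IsInitial c m u) {F : Set ℕ} (hF : ∀ f ∈ F, c ≤ f) {x : ℕ}
    (hx : x < c + u) (hxF : x ∈ F) :
    IsIrred (Λ.carrier \ F) (x + m) ↔ NoLargeSum Λ.carrier m x := by
  have h1 := h.lt_conductor
  have h2 := h.pos
  have h3 := h.le
  have hm := h.eq_of_lt
  constructor
  · intro H a ha b hb hay hby hab
    have key : ∀ a, a ∈ Λ.carrier → m < a → m + u ≤ a := by
      intro a ha hma
      by_contra hn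
      have := hm a ha (by omega)
      omega
    have h4 := key a ha hay
    have h5 := key b hb hby
    refine H a ⟨ha, fun haF => ?_⟩ b ⟨hb, fun hbF => ?_⟩ (by omega) (by omega) hab
    · have := hF a haF
      omega
    · have := hF b hbF
      omega
  · intro H a ha b hb hax hbx hab
    have key : ∀ a b, a ∈ Λ.carrier → b ∉ F → b < x + m → a + b = x + m → m < a := by
      intro a b ha hb hbx hab
      by_contra hn
      rcases hm a ha (by omega) with rfl | rfl
      · omega
      · exact hb ((show b = x by omega) ▸ hxF)
    exact H a ha.1 b hb.1 (key a b ha.1 hb.2 hbx hab) (key b a hb.1 ha.2 hax (by omega)) hab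

theorem mem_chain₁ (h : Λ.IsInitial c m u) {x : ℕ} :
    x ∈ Λ.chain₁ ↔ (c ≤ x ∧ x < c + m) ∧ IsIrred Λ.carrier x := by
  have h1 := h.lt_conductor
  have h2 := h.pos
  have h3 := h.le
  simp only [chain₁, Set.mem_ofPred_eq, h.conductor_eq]
  constructor
  · rintro ⟨hx, -, H⟩
    refine ⟨⟨hx, ?_⟩, H⟩
    by_contra hn
    exact H m h.mem_left (x - m) (h.mem_of_le _ (by omega)) (by omega) (by omega) (by omega)
  · rintro ⟨⟨hx, -⟩, H⟩
    exact ⟨hx, by omega, H⟩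

theorem mem_chain₂ (h : Λ.IsInitial c m u) {x y : ℕ} :
    (x, y) ∈ Λ.chain₂ ↔ x ∈ Λ.chain₁ ∧
      (x < y ∧ y ∈ Λ.chain₁ ∨ x < c + u ∧ NoLargeSum Λ.carrier m x ∧ y = x + m) := by
  have h1 := h.lt_conductor
  have h2 := h.pos
  have h3 := h.le
  simp only [chain₂, Set.mem_ofPred_eq]
  refine and_congr_right fun hx => ?_
  have hx' := h.mem_chain₁.1 hx
  have hF : ∀ f ∈ ({x} : Set ℕ), c ≤ f := by
    rintro f rfl
    exact hx'.1.1
  constructor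
  · rintro ⟨hxy, H⟩
    rcases Nat.lt_or_ge y (c + m) with hy | hy
    · exact Or.inl ⟨hxy, h.mem_chain₁.2 ⟨by omega, (h.isIrred_diff_iff hF hy).1 H⟩⟩
    · have hyx : y = x + m := by
        have : y - m = x := h.sub_mem_of_isIrred_diff hF hy H
        omega
      subst hyx
      have hxu : x < c + u := by
        by_contra hn
        -- If `x ≥ c + u`, the sum `(m + u) + (x - u)` survives the removal of `x`.
        refine H (m + u) ⟨h.mem_add, ?_⟩ (x - u) ⟨h.mem_of_le _ (by omega), ?_⟩ (by omega)
          (by omega) (by omega) <;> rw [Set.mem_singleton_iff] <;> have := h.add_le_conductor <;>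
          omega
      exact Or.inr ⟨hxu, (h.isIrred_diff_add_iff hF hxu rfl).1 H, rfl⟩
  · rintro (⟨hxy, hy⟩ | ⟨hxu, H, rfl⟩)
    · have hy' := h.mem_chain₁.1 hy
      exact ⟨hxy, (h.isIrred_diff_iff hF hy'.1.2).2 hy'.2⟩
    · exact ⟨by omega, (h.isIrred_diff_add_iff hF hxu rfl).2 H⟩

theorem mem_rightGens (h : Λ.IsInitial c m u) {x : ℕ} : x ∈ Λ.rightGens c m ↔ x ∈ Λ.chain₁ := by
  classical
  rw [h.mem_chain₁, rightGens, Finset.mem_filter, Finset.mem_Ico]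

theorem mem_newGens (h : Λ.IsInitial c m u) {x : ℕ} : x ∈ Λ.newGens c m u ↔
    x ∈ Λ.chain₁ ∧ x < c + u ∧ NoLargeSum Λ.carrier m x := by
  classical
  rw [h.mem_chain₁, newGens, Finset.mem_filter, Finset.mem_Ico]
  have h3 := h.le
  constructor
  · rintro ⟨h1, h2, h3⟩
    exact ⟨⟨by omega, h2⟩, by omega, h3⟩
  · rintro ⟨⟨h1, h2⟩, h3, h4⟩
    exact ⟨by omega, h2, h4⟩

theorem chain₁_eq (h : Λ.IsInitial c m u) : Λ.chain₁ = Λ.rightGens c m := by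
  ext x
  rw [Finset.mem_coe, h.mem_rightGens]

theorem chain₂_eq (h : Λ.IsInitial c m u) : Λ.chain₂ =
    (incPairs (Λ.rightGens c m) ∪ (Λ.newGens c m u).image fun x => (x, x + m) :
      Finset (ℕ × ℕ)) := by
  ext ⟨x, y⟩
  simp only [h.mem_chain₂, Finset.mem_coe, Finset.mem_union, mem_incPairs, Finset.mem_image,
    h.mem_rightGens, h.mem_newGens, Prod.mk.injEq]
  constructor
  · rintro ⟨hx, ⟨hxy, hy⟩ | ⟨h1, h2, rfl⟩⟩
    · exact Or.inl ⟨hx, hy, hxy⟩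
    · exact Or.inr ⟨x, ⟨hx, h1, h2⟩, rfl, rfl⟩
  · rintro (⟨hx, hy, hxy⟩ | ⟨x, ⟨hx, h1, h2⟩, rfl, rfl⟩)
    · exact ⟨hx, Or.inl ⟨hxy, hy⟩⟩
    · exact ⟨hx, Or.inr ⟨h1, h2, rfl⟩⟩

theorem ncard_chain₂ (h : Λ.IsInitial c m u) : Λ.chain₂.ncard =
    (Λ.rightGens c m).card.choose 2 + (Λ.newGens c m u).card := by
  rw [h.chain₂_eq, Set.ncard_coe_finset, Finset.card_union_of_disjoint, card_incPairs,
    Finset.card_image_of_injective]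
  · exact fun x y hxy => (Prod.mk.inj hxy).1
  · rw [Finset.disjoint_left]
    rintro ⟨x, y⟩ h1 h2
    simp only [mem_incPairs, Finset.mem_image, h.mem_rightGens, h.mem_newGens,
      Prod.mk.injEq] at h1 h2
    obtain ⟨x, h2, rfl, rfl⟩ := h2
    have h3 := h.mem_chain₁.1 h1.1
    have h4 := h.mem_chain₁.1 h1.2.1
    omega

/-- The elements of `chain₃` with small last component. -/
theorem chain₃_low_eq (h : Λ.IsInitial c m u) : {p ∈ Λ.chain₃ | p.2.2 < c + m + u} =
    (incTriples (Λ.rightGens c m) ∪ (((Λ.newGens c m u) ×ˢ (Λ.rightGens c m)).filter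
      fun p => p.1 ≠ p.2).image fun p => (min p.1 p.2, max p.1 p.2, p.1 + m) :
      Finset (ℕ × ℕ × ℕ)) := by
  have hu := h.pos
  have hum := h.le
  ext ⟨x, y, z⟩
  simp only [Finset.mem_coe, Finset.mem_union, mem_incTriples, Finset.mem_image, Finset.mem_filter,
    Finset.mem_product, h.mem_rightGens, h.mem_newGens, Prod.mk.injEq, Set.mem_ofPred_eq,
    Prod.exists]
  constructor
  · rintro ⟨h0, hz⟩
    obtain ⟨hxy, hyz, H⟩ := mem_chain₃_iff.1 h0
    obtain ⟨hx, hy⟩ := h.mem_chain₂.1 hxy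
    have hx' := h.mem_chain₁.1 hx
    have hF : ∀ f ∈ ({x, y} : Set ℕ), c ≤ f := by
      rintro f (rfl | rfl)
      · exact hx'.1.1
      · have := hxy.2.1
        simp only at this
        omega
    rcases Nat.lt_or_ge z (c + m) with hzm | hzm
    · rcases hy with hy | hy
      · exact Or.inl ⟨hx, hy.2, h.mem_chain₁.2 ⟨by omega, (h.isIrred_diff_iff hF hzm).1 H⟩, hy.1,
          hyz⟩
      · omega
    -- Now `z - m` is one of the two removed elements; call it `q`. The bound on `z` gives `q < c +
    -- u`, and the other element is any right generator `r ≠ q`, on either side of `q`. A pair `(x,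
    -- x + m)` cannot be extended here: `z = x + m` is not larger than `y`, and `z = x + 2m` is too
    -- large because `u ≤ m`.
    · right
      have hmem := h.sub_mem_of_isIrred_diff hF hzm H
      rcases hy with ⟨hlt, hy⟩ | hy
      · rcases hmem with hzx | hzy
        · obtain rfl : z = x + m := by omega
          have := (h.isIrred_diff_add_iff hF (by omega) (Or.inl rfl)).1 H
          exact ⟨x, y, ⟨⟨⟨hx, by omega, this⟩, hy⟩, by omega⟩, by omega, by omega, rfl⟩
        · have hzy : z - m = y := hzy
          obtain rfl : z = y + m := by omega
          have := (h.isIrred_diff_add_iff hF (by omega) (Or.inr rfl)).1 H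
          exact ⟨y, x, ⟨⟨⟨hy, by omega, this⟩, hx⟩, by omega⟩, by omega, by omega, rfl⟩
      · rcases hmem with hzx | hzy
        · omega
        · have hzy : z - m = y := hzy
          omega
  · rintro (⟨hx, hy, hz, hxy, hyz⟩ | ⟨q, r, ⟨⟨⟨hq, hqu, hqm⟩, hr⟩, hqr⟩, rfl, rfl, rfl⟩)
    · have hx' := h.mem_chain₁.1 hx
      have hz' := h.mem_chain₁.1 hz
      refine ⟨mem_chain₃_iff.2 ⟨h.mem_chain₂.2 ⟨hx, Or.inl ⟨hxy, hy⟩⟩, hyz, ?_⟩, by omega⟩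
      refine (h.isIrred_diff_iff ?_ hz'.1.2).2 hz'.2
      rintro f (rfl | rfl)
      · exact hx'.1.1
      · have : c ≤ x := hx'.1.1
        exact this.trans hxy.le
    · have hq' := h.mem_chain₁.1 hq
      have hr' := h.mem_chain₁.1 hr
      rcases lt_or_gt_of_ne hqr with hlt | hlt
      · rw [min_eq_left hlt.le, max_eq_right hlt.le]
        refine ⟨mem_chain₃_iff.2 ⟨h.mem_chain₂.2 ⟨hq, Or.inl ⟨hlt, hr⟩⟩, by omega, ?_⟩, by omega⟩
        refine (h.isIrred_diff_add_iff ?_ hqu (Or.inl rfl)).2 hqm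
        rintro f (rfl | rfl)
        · exact hq'.1.1
        · exact hr'.1.1
      · rw [min_eq_right hlt.le, max_eq_left hlt.le]
        refine ⟨mem_chain₃_iff.2 ⟨h.mem_chain₂.2 ⟨hr, Or.inl ⟨hlt, hq⟩⟩, by omega, ?_⟩, by omega⟩
        refine (h.isIrred_diff_add_iff ?_ hqu (Or.inr rfl)).2 hqm
        rintro f (rfl | rfl)
        · exact hr'.1.1
        · exact hq'.1.1

/-- Every element of `newGens` is itself a right generator, so each choice of `q` excludes exactly
one `r`. -/
theorem card_filter_ne (h : Λ.IsInitial c m u) :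
    (((Λ.newGens c m u) ×ˢ (Λ.rightGens c m)).filter fun p => p.1 ≠ p.2).card =
      (Λ.newGens c m u).card * ((Λ.rightGens c m).card - 1) := by
  have he : ((Λ.newGens c m u) ×ˢ (Λ.rightGens c m)).filter (fun p => p.1 ≠ p.2) =
      (Λ.newGens c m u).biUnion fun q => ((Λ.rightGens c m).erase q).image fun r => (q, r) := by
    ext ⟨x, y⟩
    simp only [Finset.mem_filter, Finset.mem_product, Finset.mem_biUnion, Finset.mem_image,
      Finset.mem_erase, Prod.mk.injEq]
    constructor
    · rintro ⟨⟨h1, h2⟩, h3⟩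
      exact ⟨x, h1, y, ⟨Ne.symm h3, h2⟩, rfl, rfl⟩
    · rintro ⟨_, h1, _, ⟨h2, h3⟩, rfl, rfl⟩
      exact ⟨⟨h1, h3⟩, Ne.symm h2⟩
  rw [he, Finset.card_biUnion, Finset.sum_const_nat]
  · intro q hq
    rw [Finset.card_image_of_injective _ fun x y hxy => (Prod.mk.inj hxy).2,
      Finset.card_erase_of_mem (h.mem_rightGens.2 (h.mem_newGens.1 hq).1)]
  · intro x _ y _ hxy
    rw [Function.onFun, Finset.disjoint_left]
    rintro p h1 h2
    obtain ⟨_, _, rfl⟩ := Finset.mem_image.1 h1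
    obtain ⟨_, _, h2⟩ := Finset.mem_image.1 h2
    exact hxy (Prod.mk.inj h2).1.symm

theorem ncard_chain₃_low (h : Λ.IsInitial c m u) :
    {p ∈ Λ.chain₃ | p.2.2 < c + m + u}.ncard =
      (Λ.rightGens c m).card.choose 3 +
        (Λ.newGens c m u).card * ((Λ.rightGens c m).card - 1) := by
  rw [h.chain₃_low_eq, Set.ncard_coe_finset, Finset.card_union_of_disjoint, card_incTriples,
    Finset.card_image_of_injective, h.card_filter_ne]
  -- The third entry `q + m` gives back `q`; the minimum and maximum then give `r`.
  · rintro ⟨q, r⟩ ⟨q', r'⟩ heq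
    simp only [Prod.mk.injEq] at heq ⊢
    omega
  · rw [Finset.disjoint_left]
    rintro ⟨x, y, z⟩ h1 h2
    simp only [mem_incTriples, Finset.mem_image, Finset.mem_filter, Finset.mem_product,
      h.mem_rightGens, h.mem_newGens, Prod.mk.injEq, Prod.exists] at h1 h2
    obtain ⟨q, r, ⟨⟨⟨hq, -⟩, -⟩, -⟩, -, -, rfl⟩ := h2
    have := h.mem_chain₁.1 hq
    have := h.mem_chain₁.1 h1.2.2.1
    omega

end IsInitial
end NumericalSemigroup

/-! ### Rank at least three: triples with large last entry. -/

namespace NumericalSemigroup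

variable {Λ : NumericalSemigroup} {c m u v : ℕ}

/-- The first elements of a numerical semigroup of rank at least three: `m`, `m + u` and
`m + u + v` are the three smallest nonzero elements, and `c` is the conductor. -/
structure IsInitialThree (Λ : NumericalSemigroup) (c m u v : ℕ) : Prop
    extends IsInitial Λ c m u where
  pos_three : 0 < v
  add_three_le_conductor : m + u + v ≤ c
  mem_three : m + u + v ∈ Λ.carrier
  eq_of_lt_three : ∀ x ∈ Λ.carrier, x < m + u + v → x = 0 ∨ x = m ∨ x = m + u

open Classical in
/-- The `x` such that `(x, x + u, x + (m + u))` can be removed successively. -/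
noncomputable def farGens (Λ : NumericalSemigroup) (c m u v : ℕ) : Finset ℕ :=
  (Finset.Ico c (c + v)).filter
    fun x => (x, x + u) ∈ Λ.chain₂ ∧ NoLargeSum Λ.carrier (m + u) x

theorem IsInitial.lt_of_mem_chain₂ (h : Λ.IsInitial c m u) {x y : ℕ} (hxy : (x, y) ∈ Λ.chain₂) :
    c ≤ x ∧ x < y :=
  ⟨(h.mem_chain₁.1 hxy.1).1.1, hxy.2.1⟩

theorem IsInitial.le_of_mem_pair (h : Λ.IsInitial c m u) {x y : ℕ} (hxy : (x, y) ∈ Λ.chain₂) :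
    ∀ f ∈ ({x, y} : Set ℕ), c ≤ f := by
  have := h.lt_of_mem_chain₂ hxy
  rintro f (rfl | rfl)
  · exact this.1
  · exact this.1.trans this.2.le

namespace IsInitialThree

/-- The element `m + (m + u)` exceeds `λ₂`, so it is at least `λ₃`. The next lemma uses `m + m` in
the same way. -/
theorem le_mult (h : Λ.IsInitialThree c m u v) : v ≤ m := by
  have h1 := h.eq_of_lt_three _ (Λ.add_mem_carrier h.mem_left h.mem_add)
  have := h.pos
  have := h.le
  omega

theorem add_le_mult (h : Λ.IsInitialThree c m u v) (hu : u < m) : u + v ≤ m := by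
  have h1 := h.eq_of_lt_three _ (Λ.add_mem_carrier h.mem_left h.mem_left)
  omega

theorem chain₃_high_eq (h : Λ.IsInitialThree c m u v) :
    {p ∈ Λ.chain₃ | c + m + u ≤ p.2.2} =
      ((Λ.farGens c m u v).image fun x => (x, x + u, x + (m + u)) : Finset (ℕ × ℕ × ℕ)) := by
  classical
  have hu := h.pos
  have hv := h.pos_three
  have hum := h.le
  have hvm := h.le_mult
  have hc := h.add_three_le_conductor
  have hm := h.eq_of_lt_three
  ext ⟨x, y, z⟩
  simp only [Finset.mem_coe, Finset.mem_image, farGens, Finset.mem_filter, Finset.mem_Ico,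
    Prod.mk.injEq, Set.mem_ofPred_eq]
  constructor
  · rintro ⟨h0, hz⟩
    obtain ⟨hxy, hyz, H⟩ := mem_chain₃_iff.1 h0
    have hF := h.le_of_mem_pair hxy
    have hlt := h.lt_of_mem_chain₂ hxy
    have e1 : z - m = x ∨ z - m = y := h.sub_mem_of_isIrred_diff hF (by omega) H
    -- Rank three is used here: `m + u < c`, so `m + u` cannot have been removed. With `e1`, the two
    -- removed elements are `z - (m + u) < z - m`.
    have e2 : z - (m + u) = x ∨ z - (m + u) = y := by
      by_contra hn
      refine H (m + u) ⟨h.mem_add, fun hmF => ?_⟩ (z - (m + u)) ⟨h.mem_of_le _ (by omega), hn⟩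
        (by omega) (by omega) (by omega)
      have := hF _ hmF
      omega
    obtain rfl : y = x + u := by omega
    obtain rfl : z = x + (m + u) := by omega
    have hL : NoLargeSum Λ.carrier (m + u) x := by
      intro a ha b hb ham hbm hab
      refine H a ⟨ha, ?_⟩ b ⟨hb, ?_⟩ (by omega) (by omega) hab
      · rintro (ha' | ha')
        · omega
        · have ha' : a = x + u := ha'
          have := hm b hb (by omega)
          omega
      · rintro (hb' | hb')
        · omega
        · have hb' : b = x + u := hb'
          have := hm a ha (by omega)
          omega
    refine ⟨x, ⟨⟨hlt.1, ?_⟩, hxy, hL⟩, rfl, rfl, rfl⟩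
    by_contra hn
    -- For `x ≥ c + v`, the element `λ₃` yields a forbidden sum.
    exact hL (m + u + v) h.mem_three (x - v) (h.mem_of_le _ (by omega)) (by omega) (by omega)
      (by omega)
  · rintro ⟨x, ⟨⟨hx, hxv⟩, hxy, hL⟩, rfl, rfl, rfl⟩
    refine ⟨mem_chain₃_iff.2 ⟨hxy, by omega, ?_⟩, by omega⟩
    intro a ha b hb haz hbz hab
    have key : ∀ a b, a ∈ Λ.carrier → b ∉ ({x, x + u} : Set ℕ) → b < x + (m + u) →
        a + b = x + (m + u) → m + u < a := by
      intro a b ha hb hbx hab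
      by_contra hn
      rcases hm a ha (by omega) with rfl | rfl | rfl
      · omega
      · exact hb (Or.inr (show b = x + u by omega))
      · exact hb (Or.inl (show b = x by omega))
    exact hL a ha.1 b hb.1 (key a b ha.1 hb.2 hbz hab) (key b a hb.1 ha.2 haz (by omega)) hab

theorem ncard_chain₃_high (h : Λ.IsInitialThree c m u v) :
    {p ∈ Λ.chain₃ | c + m + u ≤ p.2.2}.ncard = (Λ.farGens c m u v).card := by
  rw [h.chain₃_high_eq, Set.ncard_coe_finset, Finset.card_image_of_injective]
  exact fun x y hxy => (Prod.mk.inj hxy).1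

/-- When `u = m`, the second entry is the translate `x + m` and lies beyond the right generators of
`Λ`; the condition then becomes an order-one seed condition. -/
theorem mem_chain₂_add_iff (h : Λ.IsInitialThree c m u v) {x : ℕ} (hx : x < c + v) :
    (x, x + u) ∈ Λ.chain₂ ↔ x ∈ Λ.chain₁ ∧
      (u < m ∧ x + u ∈ Λ.chain₁ ∨ u = m ∧ NoLargeSum Λ.carrier m x) := by
  have hu := h.pos
  have hum := h.le
  have hvm := h.le_mult
  rw [h.mem_chain₂]
  refine and_congr_right fun hx1 => ?_
  constructor
  · rintro (⟨-, h1⟩ | ⟨-, h1, h2⟩)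
    · have h3 := (h.mem_chain₁.1 h1).1.2
      have h4 := (h.mem_chain₁.1 hx1).1.1
      exact Or.inl ⟨by omega, h1⟩
    · exact Or.inr ⟨by omega, h1⟩
  · rintro (⟨h1, h2⟩ | ⟨h1, h2⟩)
    · exact Or.inl ⟨by omega, h2⟩
    · exact Or.inr ⟨by omega, h2, by omega⟩

end IsInitialThree

theorem ncard_chain₃_eq_add (hlow : {p ∈ Λ.chain₃ | p.2.2 < c}.Finite)
    (hhigh : {p ∈ Λ.chain₃ | c ≤ p.2.2}.Finite) : Λ.chain₃.Finite ∧
      Λ.chain₃.ncard = {p ∈ Λ.chain₃ | p.2.2 < c}.ncard + {p ∈ Λ.chain₃ | c ≤ p.2.2}.ncard := by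
  have h : Λ.chain₃ = {p ∈ Λ.chain₃ | p.2.2 < c} ∪ {p ∈ Λ.chain₃ | c ≤ p.2.2} := by
    ext p
    simp only [Set.mem_union, Set.mem_ofPred_eq, ← and_or_left, lt_or_ge, and_true]
  constructor
  · rw [h]
    exact hlow.union hhigh
  · rw [← Set.ncard_union_eq _ hlow hhigh, ← h]
    rw [Set.disjoint_left]
    rintro p ⟨-, h1⟩ ⟨-, h2⟩
    exact absurd h1 (not_lt.2 h2)

/-! ### Rank two: `Λ` consists of `0`, `m` and everything from `c = m + u` on. -/

section RankTwo

theorem IsInitial.mem_iff_of_add_eq (h : Λ.IsInitial c m u) (hc : m + u = c) {x : ℕ} :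
    x ∈ Λ.carrier ↔ x = 0 ∨ x = m ∨ c ≤ x := by
  constructor
  · intro hx
    have := h.eq_of_lt x hx
    omega
  · rintro (rfl | rfl | hx)
    · exact Λ.zero_mem_carrier
    · exact h.mem_left
    · exact h.mem_of_le x hx

theorem IsInitial.mem_chain₁_of_add_eq (h : Λ.IsInitial c m u) (hc : m + u = c) {x : ℕ} :
    x ∈ Λ.chain₁ ↔ c ≤ x ∧ x < c + m ∧ x ≠ 2 * m := by
  have hu := h.pos
  have hmc := h.lt_conductor
  simp only [h.mem_chain₁, IsIrred, h.mem_iff_of_add_eq hc]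
  constructor
  · rintro ⟨h1, h2⟩
    refine ⟨h1.1, h1.2, ?_⟩
    rintro rfl
    exact h2 m (by omega) m (by omega) (by omega) (by omega) (by omega)
  · rintro ⟨h1, h2, h3⟩
    exact ⟨⟨h1, h2⟩, fun a ha b hb _ _ => by omega⟩

theorem IsInitial.mem_chain₂_of_add_eq (h : Λ.IsInitial c m u) (hc : m + u = c) {x y : ℕ} :
    (x, y) ∈ Λ.chain₂ ↔ (c ≤ x ∧ x < c + m ∧ x ≠ 2 * m) ∧
      (x < y ∧ c ≤ y ∧ y < c + m ∧ y ≠ 2 * m ∨ x < c + u ∧ y = x + m) := by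
  have hu := h.pos
  have hmc := h.lt_conductor
  simp only [h.mem_chain₂, h.mem_chain₁_of_add_eq hc, NoLargeSum, h.mem_iff_of_add_eq hc]
  refine and_congr_right fun hx => or_congr_right (and_congr_right fun hxu => ?_)
  -- Two elements larger than `m` sum to at least `2c`, whereas `x + m < c + u + m = 2c`.
  exact and_iff_right fun a _ b _ _ _ => by omega

theorem IsInitial.card_rightGens_of_add_eq (h : Λ.IsInitial c m u) (hc : m + u = c) :
    (Λ.rightGens c m).card = m - 1 := by
  have hu := h.le
  have hmc := h.lt_conductor
  have he : Λ.rightGens c m = (Finset.Ico c (c + m)).erase (2 * m) := by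
    ext x
    rw [h.mem_rightGens, h.mem_chain₁_of_add_eq hc, Finset.mem_erase, Finset.mem_Ico]
    omega
  rw [he, Finset.card_erase_of_mem (Finset.mem_Ico.2 (by omega)), Nat.card_Ico]
  omega

theorem IsInitial.card_newGens_of_add_eq (h : Λ.IsInitial c m u) (hc : m + u = c) :
    (Λ.newGens c m u).card = u - if m < 2 * u then 1 else 0 := by
  have hu := h.le
  have hmc := h.lt_conductor
  have he : Λ.newGens c m u = (Finset.Ico c (c + u)).erase (2 * m) := by
    ext x
    simp only [h.mem_newGens, h.mem_chain₁_of_add_eq hc, Finset.mem_erase, Finset.mem_Ico,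
      NoLargeSum, h.mem_iff_of_add_eq hc]
    constructor
    · omega
    · exact fun hx => ⟨by omega, by omega, fun a _ b _ _ _ => by omega⟩
  rw [he]
  split_ifs with hmu
  · rw [Finset.card_erase_of_mem (Finset.mem_Ico.2 (by omega)), Nat.card_Ico]
    omega
  · rw [Finset.erase_eq_of_notMem, Nat.card_Ico]
    · omega
    · rw [Finset.mem_Ico]
      omega

open Classical in
theorem IsInitial.chain₃_high_eq_of_add_eq (h : Λ.IsInitial c m u) (hc : m + u = c)
    (hu : 2 ≤ u) : {p ∈ Λ.chain₃ | c + m + u ≤ p.2.2} =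
      (({(c, c + u, 2 * c), (c, c + u + 1, 2 * c + 1), (c + 1, c + u + 1, 2 * c + 1)} :
        Finset (ℕ × ℕ × ℕ)).filter fun p => (p.1, p.2.1) ∈ Λ.chain₂ : Finset (ℕ × ℕ × ℕ)) := by
  have hum := h.le
  have hmc := h.lt_conductor
  ext ⟨x, y, z⟩
  simp only [Finset.mem_coe, Finset.mem_filter, Finset.mem_insert, Finset.mem_singleton,
    Prod.mk.injEq, Set.mem_ofPred_eq]
  constructor
  · rintro ⟨h0, hz⟩
    obtain ⟨hxy, hyz, H⟩ := mem_chain₃_iff.1 h0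
    refine ⟨?_, hxy⟩
    have hF := h.le_of_mem_pair hxy
    have hlt := h.lt_of_mem_chain₂ hxy
    have e : z - m = x ∨ z - m = y := h.sub_mem_of_isIrred_diff hF (by omega) H
    -- The sum `m + (z - m)` forces the removal of `z - m`, which is no summand of `c + (z - c)` or
    -- `(c + 1) + (z - c - 1)`. For `z ≥ 2c + 2` these are three disjoint demands on two removed
    -- elements, so `z` is `2c` or `2c + 1`.
    have e' : ∀ i, 2 * c + 2 * i ≤ z →
        (c + i = x ∨ c + i = y) ∨ z - (c + i) = x ∨ z - (c + i) = y := by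
      intro i hi
      by_contra hn
      rw [not_or] at hn
      exact H (c + i) ⟨h.mem_of_le _ (by omega), hn.1⟩ (z - (c + i))
        ⟨h.mem_of_le _ (by omega), hn.2⟩ (by omega) (by omega) (by omega)
    have e0 := e' 0 (by omega)
    have e1 := e' 1
    omega
  · rintro ⟨h0, hxy⟩
    have hlt := h.lt_of_mem_chain₂ hxy
    refine ⟨mem_chain₃_iff.2 ⟨hxy, by omega, ?_⟩, by omega⟩
    simp only [IsIrred, Set.mem_sdiff, h.mem_iff_of_add_eq hc, Set.mem_insert_iff,
      Set.mem_singleton_iff, not_or]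
    rintro a ⟨ha, hax, hay⟩ b ⟨hb, hbx, hby⟩ haz hbz hab
    omega

theorem IsInitial.ncard_chain₃_high_of_add_eq (h : Λ.IsInitial c m u) (hc : m + u = c)
    (hu : 2 ≤ u) : {p ∈ Λ.chain₃ | c + m + u ≤ p.2.2}.ncard =
      (if u = m ∨ 2 * u ≠ m then 1 else 0) + 2 * (if u + 1 < m ∧ 2 * u + 1 ≠ m then 1 else 0) +
        (if u + 1 = m then 1 else 0) := by
  classical
  have hum := h.le
  rw [h.chain₃_high_eq_of_add_eq hc hu, Set.ncard_coe_finset, Finset.card_filter,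
    Finset.sum_insert, Finset.sum_insert, Finset.sum_singleton]
  · simp only [h.mem_chain₂_of_add_eq hc]
    have e1 : ((c ≤ c ∧ c < c + m ∧ c ≠ 2 * m) ∧ (c < c + u ∧ c ≤ c + u ∧ c + u < c + m ∧
        c + u ≠ 2 * m ∨ c < c + u ∧ c + u = c + m)) ↔ u < m ∧ 2 * u ≠ m := by omega
    have e2 : ((c ≤ c ∧ c < c + m ∧ c ≠ 2 * m) ∧ (c < c + u + 1 ∧ c ≤ c + u + 1 ∧
        c + u + 1 < c + m ∧ c + u + 1 ≠ 2 * m ∨ c < c + u ∧ c + u + 1 = c + m)) ↔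
        u + 1 < m ∧ 2 * u + 1 ≠ m ∨ u + 1 = m := by omega
    have e3 : ((c ≤ c + 1 ∧ c + 1 < c + m ∧ c + 1 ≠ 2 * m) ∧ (c + 1 < c + u + 1 ∧
        c ≤ c + u + 1 ∧ c + u + 1 < c + m ∧ c + u + 1 ≠ 2 * m ∨
        c + 1 < c + u ∧ c + u + 1 = c + 1 + m)) ↔
        u + 1 < m ∧ 2 * u + 1 ≠ m ∨ u = m := by omega
    -- The alternative `u = m` in `e3` completes `e1` to the condition of `δ_b`; the clause common
    -- to `e2` and `e3` gives `2 * δ_c`; the alternative `u + 1 = m` in `e2` gives `δ_d`.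
    simp only [e1, e2, e3]
    split_ifs <;> omega
  · simp only [Finset.mem_singleton, Prod.mk.injEq]
    omega
  · simp only [Finset.mem_insert, Finset.mem_singleton, Prod.mk.injEq]
    omega

end RankTwo

/-! ### From the enumeration and the seed bitstream to the counting sets. -/

theorem elt_one (Λ : NumericalSemigroup) : Λ.elt 1 = Λ.multiplicity := rfl

theorem elt_two (Λ : NumericalSemigroup) : Λ.elt 2 = Λ.multiplicity + Λ.jump 1 := by
  have := Λ.elt_strictMono (show 1 < 2 by omega)
  simp only [jump, multiplicity, Nat.reduceAdd]
  omega

theorem elt_three (Λ : NumericalSemigroup) :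
    Λ.elt 3 = Λ.multiplicity + Λ.jump 1 + Λ.jump 2 := by
  have := Λ.elt_strictMono (show 2 < 3 by omega)
  rw [← elt_two]
  simp only [jump, Nat.reduceAdd]
  omega

theorem jump_zero (Λ : NumericalSemigroup) : Λ.jump 0 = Λ.multiplicity := by
  rw [jump, elt_zero]
  rfl

theorem conductor_eq_zero_of_rank (h : Λ.rank = 0) : Λ.conductor = 0 := by
  rw [← elt_rank, h, elt_zero]

theorem multiplicity_eq_conductor_of_rank (h : Λ.rank = 1) : Λ.multiplicity = Λ.conductor := by
  rw [← elt_rank, h]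
  rfl

theorem mem_iff_of_rank_eq_one (h : Λ.rank = 1) {x : ℕ} :
    x ∈ Λ.carrier ↔ x = 0 ∨ Λ.multiplicity ≤ x := by
  constructor
  · intro hx
    by_contra hn
    rw [not_or] at hn
    obtain ⟨i, hi, rfl⟩ := eq_elt_of_lt (j := 1) hx (by rw [elt_one]; omega)
    obtain rfl : i = 0 := by omega
    exact hn.1 Λ.elt_zero
  · rintro (rfl | hx)
    · exact Λ.zero_mem_carrier
    · exact mem_of_conductor_le (multiplicity_eq_conductor_of_rank h ▸ hx)

theorem pred_conductor_notMem (h : 0 < Λ.conductor) : Λ.conductor - 1 ∉ Λ.carrier := by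
  have := mt conductor_le_iff.2 (show ¬Λ.conductor ≤ Λ.conductor - 1 by omega)
  push Not at this
  obtain ⟨y, hy, hle⟩ := this
  have := conductor_le_iff.1 le_rfl y hy
  rwa [show Λ.conductor - 1 = y by omega]

theorem two_le_multiplicity (h : Λ.rank ≠ 0) : 2 ≤ Λ.multiplicity := by
  have h0 := Λ.elt_strictMono (Nat.pos_of_ne_zero h)
  rw [elt_zero, elt_rank] at h0
  have h1 := Λ.elt_strictMono (show 0 < 1 by omega)
  rw [elt_zero, elt_one] at h1
  by_contra hn
  have h2 : (1 : ℕ) ∈ Λ.carrier := by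
    rw [show 1 = Λ.elt 1 by rw [elt_one]; omega]
    exact Λ.elt_mem 1
  -- If `1 ∈ Λ`, every natural number is in `Λ`, including the gap `c - 1`.
  refine pred_conductor_notMem h0 ?_
  generalize Λ.conductor - 1 = n
  induction n with
  | zero => exact Λ.zero_mem_carrier
  | succ n ih => exact Λ.add_mem_carrier ih h2

theorem isInitial_of_two_le_rank (h : 2 ≤ Λ.rank) :
    Λ.IsInitial Λ.conductor Λ.multiplicity (Λ.jump 1) := by
  have hs := Λ.elt_strictMono
  have h1 := hs (show 1 < 2 by omega)
  have h2 := hs.monotone h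
  rw [elt_rank, elt_two] at h2
  rw [elt_one, elt_two] at h1
  have hmem := Λ.elt_mem 1
  rw [elt_one] at hmem
  have heq : ∀ x ∈ Λ.carrier, x < Λ.multiplicity + Λ.jump 1 → x = 0 ∨ x = Λ.multiplicity := by
    intro x hx hlt
    rw [← elt_two] at hlt
    obtain ⟨i, hi, rfl⟩ := eq_elt_of_lt hx hlt
    interval_cases i
    · exact Or.inl Λ.elt_zero
    · exact Or.inr rfl
  refine ⟨rfl, by omega, h2, by omega, ?_, fun x hx => mem_of_conductor_le hx, hmem, ?_, heq⟩
  -- The element `2m` exceeds `m`, so it is at least `λ₂ = m + u`; hence `u ≤ m`.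
  · have := heq _ (Λ.add_mem_carrier hmem hmem)
    have := two_le_multiplicity (show Λ.rank ≠ 0 by omega)
    omega
  · rw [← elt_two]
    exact Λ.elt_mem 2

theorem isInitialThree_of_three_le_rank (h : 3 ≤ Λ.rank) :
    Λ.IsInitialThree Λ.conductor Λ.multiplicity (Λ.jump 1) (Λ.jump 2) := by
  have hs := Λ.elt_strictMono
  have h1 := hs (show 2 < 3 by omega)
  have h2 := hs.monotone h
  rw [elt_rank, elt_three] at h2
  rw [elt_two, elt_three] at h1
  refine ⟨isInitial_of_two_le_rank (by omega), by omega, h2, ?_, ?_⟩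
  · rw [← elt_three]
    exact Λ.elt_mem 3
  · intro x hx hlt
    rw [← elt_three] at hlt
    obtain ⟨i, hi, rfl⟩ := eq_elt_of_lt hx hlt
    interval_cases i
    · exact Or.inl Λ.elt_zero
    · exact Or.inr (Or.inl rfl)
    · exact Or.inr (Or.inr Λ.elt_two)

theorem two_le_jump_of_rank_eq_two (h : Λ.rank = 2) :
    Λ.multiplicity + Λ.jump 1 = Λ.conductor ∧ 2 ≤ Λ.jump 1 := by
  have h1 := isInitial_of_two_le_rank h.ge
  have h2 : Λ.multiplicity + Λ.jump 1 = Λ.conductor := by rw [← elt_two, ← elt_rank, h]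
  refine ⟨h2, ?_⟩
  have hp := h1.pos
  have hlt := h1.lt_conductor
  by_contra hn
  -- With `u = 1` the gap `c - 1` would be `m`.
  refine pred_conductor_notMem (Λ := Λ) (Nat.zero_lt_of_lt hlt) ?_
  rw [show Λ.conductor - 1 = Λ.multiplicity by omega]
  exact h1.mem_left

/-- An order-zero seed is a right generator: when two numbers sum to `x`, both are positive exactly
when both are smaller than `x`. -/
theorem seedBitstream_eq_true_iff_isIrred (h : 1 ≤ Λ.rank) {i : ℕ} (hi : i < Λ.multiplicity) :
    Λ.seedBitstream i = true ↔ IsIrred Λ.carrier (Λ.conductor + i) := by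
  have := seedBitstream_elt_add (Λ := Λ) (j := 0) (i := i) h (by rwa [jump_zero])
  rw [elt_zero, zero_add, add_zero] at this
  rw [this]
  exact ⟨fun H a ha b hb _ _ hab => H a ha b hb (by omega) (by omega) hab,
    fun H a ha b hb _ _ hab => H a ha b hb (by omega) (by omega) hab⟩

theorem seedBitstream_add_elt_one (h : 2 ≤ Λ.rank) {i : ℕ} (hi : i < Λ.jump 1) :
    Λ.seedBitstream (i + Λ.multiplicity) = true ↔
      NoLargeSum Λ.carrier Λ.multiplicity (Λ.conductor + i) := by
  rw [← elt_one, add_comm]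
  exact seedBitstream_elt_add h hi

theorem seedBitstream_add_elt_two (h : 3 ≤ Λ.rank) {i : ℕ} (hi : i < Λ.jump 2) :
    Λ.seedBitstream (i + (Λ.jump 1 + Λ.multiplicity)) = true ↔
      NoLargeSum Λ.carrier (Λ.multiplicity + Λ.jump 1) (Λ.conductor + i) := by
  rw [add_comm (Λ.jump 1), ← elt_two, add_comm]
  exact seedBitstream_elt_add h hi

theorem weight_seedBitstream (h : 2 ≤ Λ.rank) :
    Λ.seedBitstream.weight 0 (Λ.multiplicity - 1) =
      (Λ.rightGens Λ.conductor Λ.multiplicity).card := by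
  classical
  have := two_le_multiplicity (show Λ.rank ≠ 0 by omega)
  rw [Bitstream.weight_eq_card_filter_Ico (c := Λ.conductor) (by omega)
    (fun x => IsIrred Λ.carrier x)
    fun i hi => seedBitstream_eq_true_iff_isIrred (by omega) hi, rightGens]

theorem weight_conj_shift (h : 2 ≤ Λ.rank) :
    (Λ.seedBitstream.conj (Λ.seedBitstream.shift Λ.multiplicity)).weight 0 (Λ.jump 1 - 1) =
      (Λ.newGens Λ.conductor Λ.multiplicity (Λ.jump 1)).card := by
  classical
  have hI := isInitial_of_two_le_rank h
  have hle := hI.le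
  rw [Bitstream.weight_eq_card_filter_Ico (c := Λ.conductor) hI.pos
    (fun x => IsIrred Λ.carrier x ∧ NoLargeSum Λ.carrier Λ.multiplicity x), newGens]
  intro i hi
  simp only [Bitstream.conj, Bitstream.shift, Bool.and_eq_true]
  rw [seedBitstream_eq_true_iff_isIrred (by omega) (by omega), seedBitstream_add_elt_one h hi]

theorem weight_conj_shift_shift (h : 3 ≤ Λ.rank) :
    (Λ.seedBitstream.conj ((Λ.seedBitstream.shift (Λ.jump 1)).conj
      (Λ.seedBitstream.shift (Λ.jump 1 + Λ.multiplicity)))).weight 0 (Λ.jump 2 - 1) =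
      (Λ.farGens Λ.conductor Λ.multiplicity (Λ.jump 1) (Λ.jump 2)).card := by
  classical
  have hI := isInitialThree_of_three_le_rank h
  have hle := hI.le
  have hvm := hI.le_mult
  rw [Bitstream.weight_eq_card_filter_Ico (c := Λ.conductor) hI.pos_three
    (fun x => (x, x + Λ.jump 1) ∈ Λ.chain₂ ∧
      NoLargeSum Λ.carrier (Λ.multiplicity + Λ.jump 1) x), farGens]
  intro i hi
  simp only [Bitstream.conj, Bitstream.shift, Bool.and_eq_true]
  rw [seedBitstream_eq_true_iff_isIrred (by omega) (by omega), seedBitstream_add_elt_two h hi,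
    ← and_assoc]
  refine and_congr_left fun _ => ?_
  rw [hI.mem_chain₂_add_iff (by omega), hI.mem_chain₁, hI.mem_chain₁]
  have e1 : Λ.conductor ≤ Λ.conductor + i ∧ Λ.conductor + i < Λ.conductor + Λ.multiplicity := by
    omega
  rw [and_iff_right e1]
  refine and_congr_right fun _ => ?_
  -- The bit at `i + u` has two meanings. If `u < m`, then `i + u < u + v ≤ m` and it is an
  -- order-zero bit; if `u = m`, it is the order-one bit at `i + m`. These match the two cases of
  -- `mem_chain₂_add_iff`.
  rcases hle.lt_or_eq with hlt | heq
  · have hadd := hI.add_le_mult hlt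
    rw [seedBitstream_eq_true_iff_isIrred (by omega) (by omega), ← add_assoc]
    have e2 : Λ.conductor ≤ Λ.conductor + i + Λ.jump 1 ∧
        Λ.conductor + i + Λ.jump 1 < Λ.conductor + Λ.multiplicity := by omega
    simp only [hlt, hlt.ne, e2, and_self, true_and, false_and, or_false]
  · rw [heq, seedBitstream_add_elt_one (by omega) (by omega)]
    simp

/-! ### Finiteness and counts for each rank. -/

theorem finite_and_ncard_of_rank_eq_zero (h : Λ.rank = 0) :
    (Λ.chain₁.Finite ∧ Λ.chain₂.Finite ∧ Λ.chain₃.Finite) ∧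
      Λ.chain₁.ncard = 1 ∧ Λ.chain₂.ncard = 2 ∧ Λ.chain₃.ncard = 4 := by
  have hc := conductor_eq_zero_of_rank h
  have hM : ∀ x, x ∈ Λ.carrier := fun x => mem_of_conductor_le (by omega)
  have h3 : Λ.chain₃ = (({(1, 2, 3), (1, 2, 4), (1, 2, 5), (1, 3, 5)} :
      Finset (ℕ × ℕ × ℕ)) : Set (ℕ × ℕ × ℕ)) := by
    rw [chain₃_of_conductor_eq_zero hM hc]
    simp
  have h2 : Λ.chain₂ = (({(1, 2), (1, 3)} : Finset (ℕ × ℕ)) : Set (ℕ × ℕ)) := by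
    rw [chain₂_of_conductor_eq_zero hM hc]
    simp
  rw [chain₁_of_conductor_eq_zero hM hc, h2, h3, Set.ncard_coe_finset, Set.ncard_coe_finset,
    Set.ncard_singleton]
  exact ⟨⟨Set.finite_singleton _, Finset.finite_toSet _, Finset.finite_toSet _⟩, rfl, rfl, rfl⟩

theorem finite_and_ncard_of_rank_eq_one (h : Λ.rank = 1) :
    (Λ.chain₁.Finite ∧ Λ.chain₂.Finite ∧ Λ.chain₃.Finite) ∧
      Λ.chain₁.ncard = Λ.multiplicity ∧ Λ.chain₂.ncard = Λ.multiplicity.choose 2 + 3 ∧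
      (Λ.multiplicity = 2 ∨ Λ.multiplicity = 3 →
        Λ.chain₃.ncard = Λ.multiplicity.choose 3 + 3 * Λ.multiplicity + 1) ∧
      (4 ≤ Λ.multiplicity →
        Λ.chain₃.ncard = Λ.multiplicity.choose 3 + 3 * Λ.multiplicity + 3) := by
  have hc := (multiplicity_eq_conductor_of_rank h).symm
  have hm := two_le_multiplicity (show Λ.rank ≠ 0 by omega)
  have hM := fun x => mem_iff_of_rank_eq_one h (x := x)
  generalize Λ.multiplicity = m at hc hm hM
  refine ⟨⟨?_, ?_, ?_⟩, ?_, ncard_chain₂_of_ordinary hm hM hc, ?_,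
    fun hm => ncard_chain₃_of_ordinary hm hM hc⟩
  · rw [chain₁_of_ordinary hm hM hc]
    exact Finset.finite_toSet _
  · rw [chain₂_of_ordinary hm hM hc]
    exact Finset.finite_toSet _
  · refine (Finset.finite_toSet (Finset.range (2 * m + 4) ×ˢ Finset.range (2 * m + 4) ×ˢ
      Finset.range (2 * m + 4))).subset ?_
    rintro ⟨x, y, z⟩ hp
    obtain ⟨h1, h2, h3, -, h5⟩ := (mem_chain₃_of_ordinary hm hM hc).1 hp
    simp only [Finset.mem_coe, Finset.mem_product, Finset.mem_range]
    omega
  · rw [chain₁_of_ordinary hm hM hc, Set.ncard_coe_finset, Nat.card_Ico]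
    omega
  · rintro (rfl | rfl)
    · exact ncard_chain₃_of_ordinary_two hM hc
    · exact ncard_chain₃_of_ordinary_three hM hc

namespace IsInitial

variable {c m u : ℕ}

theorem ncard_chain₁ (h : Λ.IsInitial c m u) : Λ.chain₁.ncard = (Λ.rightGens c m).card := by
  rw [h.chain₁_eq, Set.ncard_coe_finset]

theorem finite_chain₁ (h : Λ.IsInitial c m u) : Λ.chain₁.Finite := by
  rw [h.chain₁_eq]
  exact Finset.finite_toSet _

theorem finite_chain₂ (h : Λ.IsInitial c m u) : Λ.chain₂.Finite := by
  rw [h.chain₂_eq]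
  exact Finset.finite_toSet _

theorem finite_chain₃_low (h : Λ.IsInitial c m u) :
    {p ∈ Λ.chain₃ | p.2.2 < c + m + u}.Finite := by
  rw [h.chain₃_low_eq]
  exact Finset.finite_toSet _

/-- Truncated and integer subtraction differ only when there are no right generators; then `newGens`
is empty and both products vanish. -/
theorem cast_card_newGens_mul (h : Λ.IsInitial c m u) :
    (((Λ.newGens c m u).card * ((Λ.rightGens c m).card - 1) : ℕ) : ℤ) =
      (Λ.newGens c m u).card * ((Λ.rightGens c m).card - 1) := by
  rcases Nat.eq_zero_or_pos (Λ.rightGens c m).card with h0 | h0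
  · have : Λ.newGens c m u = ∅ := by
      rw [Finset.eq_empty_iff_forall_notMem]
      intro x hx
      have := h.mem_rightGens.2 (h.mem_newGens.1 hx).1
      rw [Finset.card_eq_zero.1 h0] at this
      exact Finset.notMem_empty _ this
    simp [this]
  · push_cast [Nat.cast_sub h0]
    rfl

end IsInitial

theorem finite_and_ncard_chain₃_of_rank_eq_two (h : Λ.rank = 2) : Λ.chain₃.Finite ∧
    (Λ.chain₃.ncard : ℤ) = ((Λ.multiplicity - 1).choose 3 : ℤ) +
      (Λ.jump 1 - if Λ.multiplicity < 2 * Λ.jump 1 then 1 else 0) * (Λ.multiplicity - 2) +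
      (if Λ.jump 1 = Λ.multiplicity ∨ 2 * Λ.jump 1 ≠ Λ.multiplicity then 1 else 0) +
      2 * (if Λ.jump 1 + 1 < Λ.multiplicity ∧ 2 * Λ.jump 1 + 1 ≠ Λ.multiplicity then 1 else 0) +
      (if Λ.jump 1 + 1 = Λ.multiplicity then 1 else 0) := by
  classical
  have hI := isInitial_of_two_le_rank h.ge
  obtain ⟨hc, hu⟩ := two_le_jump_of_rank_eq_two h
  have hm := two_le_multiplicity (show Λ.rank ≠ 0 by omega)
  have hlow := hI.finite_chain₃_low
  have hhigh : {p ∈ Λ.chain₃ | Λ.conductor + Λ.multiplicity + Λ.jump 1 ≤ p.2.2}.Finite := by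
    rw [hI.chain₃_high_eq_of_add_eq hc hu]
    exact Finset.finite_toSet _
  obtain ⟨hfin, hcard⟩ := ncard_chain₃_eq_add hlow hhigh
  refine ⟨hfin, ?_⟩
  rw [hcard, hI.ncard_chain₃_low, hI.ncard_chain₃_high_of_add_eq hc hu, Nat.cast_add,
    Nat.cast_add, hI.cast_card_newGens_mul, hI.card_rightGens_of_add_eq hc,
    hI.card_newGens_of_add_eq hc]
  have e1 : ((Λ.multiplicity - 1 : ℕ) : ℤ) = Λ.multiplicity - 1 := by omega
  have e2 : ((Λ.jump 1 - (if Λ.multiplicity < 2 * Λ.jump 1 then 1 else 0) : ℕ) : ℤ) =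
      Λ.jump 1 - if Λ.multiplicity < 2 * Λ.jump 1 then 1 else 0 := by
    split_ifs <;> omega
  rw [e1, e2]
  push_cast
  ring

theorem finite_and_ncard_chain₃_of_three_le_rank (h : 3 ≤ Λ.rank) : Λ.chain₃.Finite ∧
    (Λ.chain₃.ncard : ℤ) = (Λ.chain₁.ncard.choose 3 : ℤ) +
      ((Λ.seedBitstream.conj (Λ.seedBitstream.shift Λ.multiplicity)).weight 0 (Λ.jump 1 - 1) : ℤ) *
        ((Λ.chain₁.ncard : ℤ) - 1) +
      ((Λ.seedBitstream.conj ((Λ.seedBitstream.shift (Λ.jump 1)).conj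
        (Λ.seedBitstream.shift (Λ.jump 1 + Λ.multiplicity)))).weight 0 (Λ.jump 2 - 1) : ℤ) := by
  have hI := isInitialThree_of_three_le_rank h
  have hlow := hI.finite_chain₃_low
  have hhigh : {p ∈ Λ.chain₃ | Λ.conductor + Λ.multiplicity + Λ.jump 1 ≤ p.2.2}.Finite := by
    rw [hI.chain₃_high_eq]
    exact Finset.finite_toSet _
  obtain ⟨hfin, hcard⟩ := ncard_chain₃_eq_add hlow hhigh
  refine ⟨hfin, ?_⟩
  rw [hcard, hI.ncard_chain₃_low, hI.ncard_chain₃_high, weight_conj_shift (by omega),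
    weight_conj_shift_shift h, hI.ncard_chain₁, Nat.cast_add, Nat.cast_add,
    hI.cast_card_newGens_mul]

end NumericalSemigroup

open NumericalSemigroup in
theorem mainTheorem2 (Λ : NumericalSemigroup) (k m u v : ℕ) (S : Bitstream)
    (hk : k = Λ.rank) (hm : m = Λ.multiplicity) (hu : u = Λ.jump 1) (hv : v = Λ.jump 2)
    (hS : S = Λ.seedBitstream)
    (nc ngc nggc : ℕ) (hnc : nc = Λ.children.ncard) (hngc : ngc = Λ.grandchildren.ncard)
    (hnggc : nggc = Λ.greatGrandchildren.ncard)
    (δa δb δc δd : ℤ)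
    (hδa : δa = if m < 2 * u then 1 else 0)
    (hδb : δb = if u = m ∨ 2 * u ≠ m then 1 else 0)
    (hδc : δc = if (u : ℤ) < (m : ℤ) - 1 ∧ 2 * u + 1 ≠ m then 1 else 0)
    (hδd : δd = if (u : ℤ) = (m : ℤ) - 1 then 1 else 0) :
    -- all three sets of descendants are finite, so that `ncard` counts them
    (Λ.children.Finite ∧ Λ.grandchildren.Finite ∧ Λ.greatGrandchildren.Finite) ∧
    -- the number of children
    ((k = 0 → nc = 1) ∧
      (k = 1 → nc = m) ∧
      (k = 2 → (nc : ℤ) = (m : ℤ) - 1) ∧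
      (3 ≤ k → nc = S.weight 0 (m - 1))) ∧
    -- the number of grandchildren
    ((k = 0 → ngc = 2) ∧
      (k = 1 → ngc = m.choose 2 + 3) ∧
      (1 < k → ngc = nc.choose 2 + (S.conj (S.shift m)).weight 0 (u - 1))) ∧
    -- the number of great-grandchildren
    ((k = 0 → nggc = 4) ∧
      (k = 1 → (m = 2 ∨ m = 3) → nggc = m.choose 3 + 3 * m + 1) ∧
      (k = 1 → 4 ≤ m → nggc = m.choose 3 + 3 * m + 3) ∧
      (k = 2 → (nggc : ℤ) =
        ((m - 1).choose 3 : ℤ) + ((u : ℤ) - δa) * ((m : ℤ) - 2) + δb + 2 * δc + δd) ∧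
      (3 ≤ k → (nggc : ℤ) =
        (nc.choose 3 : ℤ) + ((S.conj (S.shift m)).weight 0 (u - 1) : ℤ) * ((nc : ℤ) - 1) +
          ((S.conj ((S.shift u).conj (S.shift (u + m)))).weight 0 (v - 1) : ℤ))) := by
  rw [ncard_children] at hnc
  rw [ncard_grandchildren] at hngc
  rw [ncard_greatGrandchildren] at hnggc
  rw [children_eq_image, grandchildren_eq_image, greatGrandchildren_eq_image]
  have hfinite : Λ.chain₁.Finite ∧ Λ.chain₂.Finite ∧ Λ.chain₃.Finite := by
    obtain h | h | h | h : Λ.rank = 0 ∨ Λ.rank = 1 ∨ Λ.rank = 2 ∨ 3 ≤ Λ.rank := by omega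
    · exact (finite_and_ncard_of_rank_eq_zero h).1
    · exact (finite_and_ncard_of_rank_eq_one h).1
    · have hI := isInitial_of_two_le_rank h.ge
      exact ⟨hI.finite_chain₁, hI.finite_chain₂, (finite_and_ncard_chain₃_of_rank_eq_two h).1⟩
    · have hI := isInitial_of_two_le_rank (show 2 ≤ Λ.rank by omega)
      exact ⟨hI.finite_chain₁, hI.finite_chain₂, (finite_and_ncard_chain₃_of_three_le_rank h).1⟩
  refine ⟨⟨hfinite.1.image _, hfinite.2.1.image _, hfinite.2.2.image _⟩, ⟨?_, ?_, ?_, ?_⟩,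
    ⟨?_, ?_, ?_⟩, ?_, ?_, ?_, ?_, ?_⟩ <;> subst hk hm hu hv hS hnc hngc hnggc
  · exact fun h => (finite_and_ncard_of_rank_eq_zero h).2.1
  · exact fun h => (finite_and_ncard_of_rank_eq_one h).2.1
  · intro h
    have hI := isInitial_of_two_le_rank h.ge
    have hm := two_le_multiplicity (show Λ.rank ≠ 0 by omega)
    rw [hI.ncard_chain₁, hI.card_rightGens_of_add_eq (two_le_jump_of_rank_eq_two h).1]
    omega
  · intro h
    rw [(isInitial_of_two_le_rank (by omega)).ncard_chain₁, weight_seedBitstream (by omega)]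
  · exact fun h => (finite_and_ncard_of_rank_eq_zero h).2.2.1
  · exact fun h => (finite_and_ncard_of_rank_eq_one h).2.2.1
  · intro h
    have hI := isInitial_of_two_le_rank h
    rw [hI.ncard_chain₂, hI.ncard_chain₁, weight_conj_shift h]
  · exact fun h => (finite_and_ncard_of_rank_eq_zero h).2.2.2
  · exact fun h => (finite_and_ncard_of_rank_eq_one h).2.2.2.1
  · exact fun h => (finite_and_ncard_of_rank_eq_one h).2.2.2.2
  · intro h
    have e1 : ((Λ.jump 1 : ℤ) < (Λ.multiplicity : ℤ) - 1 ∧ 2 * Λ.jump 1 + 1 ≠ Λ.multiplicity) ↔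
        Λ.jump 1 + 1 < Λ.multiplicity ∧ 2 * Λ.jump 1 + 1 ≠ Λ.multiplicity := by omega
    have e2 : ((Λ.jump 1 : ℤ) = (Λ.multiplicity : ℤ) - 1) ↔
        Λ.jump 1 + 1 = Λ.multiplicity := by omega
    rw [(finite_and_ncard_chain₃_of_rank_eq_two h).2, hδa, hδb, hδc, hδd]
    simp only [e1, e2]
  · exact fun h => (finite_and_ncard_chain₃_of_three_le_rank h).2
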